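/- Conventions. Manifolds are smooth, finite-dimensional, Hausdorff and without boundary, and Riemannian metrics are smooth. A Sasakian manifold $M(\phi,\xi,\eta,g_M)$ is a Riemannian manifold $(M,g_M)$ with a smooth $(1,1)$-tensor field $\phi$, a smooth vector field $\xi$ and a smooth 1-form $\eta$ such that $\phi^2=-I+\eta\otimes\xi$, $\phi\xi=0$, $\eta\circ\phi=0$, $\eta(\xi)=1$, $g_M(\phi X,\phi Y)=g_M(X,Y)-\eta(X)\eta(Y)$, $\eta(X)=g_M(X,\xi)$, $d\eta(X,Y)=g_M(X,\phi Y)$ and $[\phi,\phi]+2\,d\eta\otimes\xi=0$. Here $2\,d\eta(X,Y)=X\eta(Y)-Y\eta(X)-\eta([X,Y])$ and $[\phi,\phi](X,Y)=\phi^2[X,Y]+[\phi X,\phi Y]-\phi[\phi X,Y]-\phi[X,\phi Y]$. A Riemannian submersion $F:(M,g_M)\to(N,g_N)$ is a smooth surjective map whose differential $F_*$ is surjective at every point and preserves the lengths of the vectors in $(\ker F_*)^{\perp}$. Vector fields in $\Gamma(\ker F_*)$ are called vertical, those in $\Gamma((\ker F_*)^\perp)$ horizontal, and $\mathcal V$,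 $\mathcal H$ are the orthogonal projections onto $\ker F_*$ and $(\ker F_*)^\perp$. With $\nabla$ the Levi-Civita connection of $g_M$, put $$\mathcal T_EG=\mathcal H\nabla_{\mathcal VE}\mathcal VG+\mathcal V\nabla_{\mathcal VE}\mathcal HG,\qquad \mathcal A_EG=\mathcal V\nabla_{\mathcal HE}\mathcal HG+\mathcal H\nabla_{\mathcal HE}\mathcal VG .$$ The second fundamental form of $F$ is $(\nabla F_*)(X,Y)=\nabla^F_XF_*Y-F_*(\nabla_XY)$ for smooth vector fields $X,Y$ on $M$, where $\nabla^F$ is the pullback to $F^{-1}TN$ of the Levi-Civita connection of $g_N$; $F$ is totally geodesic if $\nabla F_*=0$. Theorem. Let $M(\phi,\xi,\eta,g_M)$ be a Sasakian manifold, let $(N,g_N)$ be a Riemannian manifold, and let $F:M\to N$ be an anti-invariant Riemannian submersion, i.e. a Riemannian submersion with $\phi(\ker F_*)\subseteq(\ker F_*)^\perp$, such that $(\ker F_*)^\perp=\phi(\ker F_*)\oplus\langle\xi\rangle$. Then $F$ is a totally geodesic map if and only if $$\mathcal T_W\phi V=0\quad\text{for all } V,W\in\Gamma(\ker F_*)$$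 and $$\mathcal A_X\phi W=0\quad\text{for all } X\in\Gamma((\ker F_*)^\perp),\ W\in\Gamma(\ker F_*).$$ -/

import Mathlib

open scoped Manifold ContDiff Topology Bundle

namespace SasakianSubmersion

open Bundle VectorField FiberBundle

noncomputable section

/-! ### The Levi-Civita connection, built from the Koszul formula -/

section LeviCivita

variable {E : Type*} [NormedAddCommGroup E] [NormedSpace ℝ E] [FiniteDimensional ℝ E]
  {H : Type*} [TopologicalSpace H] (I : ModelWithCorners ℝ E H)
  {M : Type*} [TopologicalSpace M] [ChartedSpace H M] [IsManifold I ∞ M]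
  [RiemannianBundle (fun x : M ↦ TangentSpace I x)]
  [IsContMDiffRiemannianBundle I ∞ E (fun x : M ↦ TangentSpace I x)]

/-- The right-hand side of the Koszul formula for `g (∇_X Y, Z)` at the point `x`. -/
def koszul (X Y Z : Π x : M, TangentSpace I x) (x : M) : ℝ :=
  (1 / 2 : ℝ) *
    (mvfderiv I (fun y ↦ inner ℝ (Y y) (Z y)) x (X x)
      + mvfderiv I (fun y ↦ inner ℝ (X y) (Z y)) x (Y x)
      - mvfderiv I (fun y ↦ inner ℝ (X y) (Y y)) x (Z x)
      + inner ℝ (mlieBracket I X Y x) (Z x)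
      - inner ℝ (mlieBracket I X Z x) (Y x)
      - inner ℝ (mlieBracket I Y Z x) (X x))

instance (x : M) : FiniteDimensional ℝ (TangentSpace I x) := inferInstanceAs (FiniteDimensional ℝ E)

theorem mdifferentiableAt_inner {X Y : Π x : M, TangentSpace I x} {x : M}
    (hX : MDiffAt (T% X) x) (hY : MDiffAt (T% Y) x) :
    MDiffAt (fun y ↦ (inner ℝ (X y) (Y y) : ℝ)) x :=
  MDifferentiableAt.inner_bundle (F := E) (E := fun x : M ↦ TangentSpace I x) (IB := I)
    (b := fun y ↦ y) (v := X) (w := Y) hX hY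

theorem tensorialAt_koszul_left {Y Z : Π x : M, TangentSpace I x} {x : M}
    (hY : MDiffAt (T% Y) x) (hZ : MDiffAt (T% Z) x) :
    TensorialAt I E (fun X ↦ koszul I X Y Z x) x where
  smul {f X} hf hX := by
    have h1 := mvfderiv_mul hf (mdifferentiableAt_inner I hX hZ)
    have h2 := mvfderiv_mul hf (mdifferentiableAt_inner I hX hY)
    have e1 : (fun y ↦ inner ℝ ((f • X) y) (Z y)) = f * (fun y ↦ inner ℝ (X y) (Z y)) := by
      ext y; simp [inner_smul_left]
    have e2 : (fun y ↦ inner ℝ ((f • X) y) (Y y)) = f * (fun y ↦ inner ℝ (X y) (Y y)) := by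
      ext y; simp [inner_smul_left]
    simp only [koszul, e1, e2, h1, h2, mlieBracket_smul_left hf hX]
    simp [inner_add_left, inner_smul_left, inner_smul_right, inner_neg_left, real_inner_comm]
    ring
  add {X X'} hX hX' := by
    have h1 := mvfderiv_add (mdifferentiableAt_inner I hX hZ) (mdifferentiableAt_inner I hX' hZ)
    have h2 := mvfderiv_add (mdifferentiableAt_inner I hX hY) (mdifferentiableAt_inner I hX' hY)
    have e1 : (fun y ↦ inner ℝ ((X + X') y) (Z y)) =
        (fun y ↦ inner ℝ (X y) (Z y)) + (fun y ↦ inner ℝ (X' y) (Z y)) := by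
      ext y; simp [inner_add_left]
    have e2 : (fun y ↦ inner ℝ ((X + X') y) (Y y)) =
        (fun y ↦ inner ℝ (X y) (Y y)) + (fun y ↦ inner ℝ (X' y) (Y y)) := by
      ext y; simp [inner_add_left]
    simp only [koszul, e1, e2, h1, h2, mlieBracket_add_left hX hX']
    simp [inner_add_left, inner_add_right]
    ring

theorem tensorialAt_koszul_right {X Y : Π x : M, TangentSpace I x} {x : M}
    (hX : MDiffAt (T% X) x) (hY : MDiffAt (T% Y) x) :
    TensorialAt I E (fun Z ↦ koszul I X Y Z x) x where
  smul {f Z} hf hZ := by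
    have h1 := mvfderiv_mul hf (mdifferentiableAt_inner I hX hZ)
    have h2 := mvfderiv_mul hf (mdifferentiableAt_inner I hY hZ)
    have e1 : (fun y ↦ inner ℝ (X y) ((f • Z) y)) = f * (fun y ↦ inner ℝ (X y) (Z y)) := by
      ext y; simp [inner_smul_right]
    have e2 : (fun y ↦ inner ℝ (Y y) ((f • Z) y)) = f * (fun y ↦ inner ℝ (Y y) (Z y)) := by
      ext y; simp [inner_smul_right]
    simp only [koszul, e1, e2, h1, h2, mlieBracket_smul_right hf hZ]
    simp [inner_add_left, inner_smul_left, inner_smul_right, real_inner_comm]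
    ring
  add {Z Z'} hZ hZ' := by
    have h1 := mvfderiv_add (mdifferentiableAt_inner I hX hZ) (mdifferentiableAt_inner I hX hZ')
    have h2 := mvfderiv_add (mdifferentiableAt_inner I hY hZ) (mdifferentiableAt_inner I hY hZ')
    have e1 : (fun y ↦ inner ℝ (X y) ((Z + Z') y)) =
        (fun y ↦ inner ℝ (X y) (Z y)) + (fun y ↦ inner ℝ (X y) (Z' y)) := by
      ext y; simp [inner_add_right]
    have e2 : (fun y ↦ inner ℝ (Y y) ((Z + Z') y)) =
        (fun y ↦ inner ℝ (Y y) (Z y)) + (fun y ↦ inner ℝ (Y y) (Z' y)) := by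
      ext y; simp [inner_add_right]
    simp only [koszul, e1, e2, h1, h2, mlieBracket_add_right hZ hZ']
    simp [inner_add_left, inner_add_right]
    ring

open scoped Classical in
/-- `g (∇_v Y, w)` at `x`, as a bilinear form in `(v, w)`; zero if `Y` is not differentiable
at `x`. -/
def koszulForm (Y : Π x : M, TangentSpace I x) (x : M) :
    TangentSpace I x →L[ℝ] TangentSpace I x →L[ℝ] ℝ :=
  if hY : MDiffAt (T% Y) x then
    TensorialAt.mkHom₂ (fun X Z ↦ koszul I X Y Z x) x
      (fun _ hZ ↦ tensorialAt_koszul_left I hY hZ) (fun _ hX ↦ tensorialAt_koszul_right I hX hY)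
  else 0

instance (x : M) : CompleteSpace (TangentSpace I x) := FiniteDimensional.complete ℝ _

theorem koszulForm_apply {X Y Z : Π x : M, TangentSpace I x} {x : M} (hX : MDiffAt (T% X) x)
    (hY : MDiffAt (T% Y) x) (hZ : MDiffAt (T% Z) x) :
    koszulForm I Y x (X x) (Z x) = koszul I X Y Z x := by
  rw [koszulForm, dif_pos hY]
  exact TensorialAt.mkHom₂_apply _ _ hX hZ

/-- The covariant derivative `∇ Y`, as an endomorphism of each tangent space: `v ↦ ∇_v Y` is the vector
representing `w ↦ g (∇_v Y, w)`. -/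
def leviCivitaFun (Y : Π x : M, TangentSpace I x) (x : M) :
    TangentSpace I x →L[ℝ] TangentSpace I x :=
  LinearMap.toContinuousLinearMap
    { toFun := fun v ↦ (InnerProductSpace.toDual ℝ (TangentSpace I x)).symm (koszulForm I Y x v)
      map_add' := by intro v w; simp
      map_smul' := by intro c v; simp }

theorem inner_leviCivitaFun (Y : Π x : M, TangentSpace I x) (x : M) (v w : TangentSpace I x) :
    inner ℝ (leviCivitaFun I Y x v) w = koszulForm I Y x v w := by
  simp [leviCivitaFun]


theorem koszulForm_apply_extend {Y : Π x : M, TangentSpace I x} {x : M}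
    (hY : MDiffAt (T% Y) x) (v w : TangentSpace I x) :
    koszulForm I Y x v w
      = koszul I (extend E v) Y (extend E w) x := by
  rw [koszulForm, dif_pos hY]
  exact TensorialAt.mkHom₂_apply_eq_extend _ _ _ _

theorem koszul_add {X Y Y' Z : Π x : M, TangentSpace I x} {x : M} (hX : MDiffAt (T% X) x)
    (hY : MDiffAt (T% Y) x) (hY' : MDiffAt (T% Y') x) (hZ : MDiffAt (T% Z) x) :
    koszul I X (Y + Y') Z x = koszul I X Y Z x + koszul I X Y' Z x := by
  have h1 := mvfderiv_add (mdifferentiableAt_inner I hX hY) (mdifferentiableAt_inner I hX hY')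
  have h2 := mvfderiv_add (mdifferentiableAt_inner I hY hZ) (mdifferentiableAt_inner I hY' hZ)
  have e1 : (fun y ↦ (inner ℝ (X y) ((Y + Y') y) : ℝ)) =
      (fun y ↦ inner ℝ (X y) (Y y)) + (fun y ↦ inner ℝ (X y) (Y' y)) := by
    ext y; simp [inner_add_right]
  have e2 : (fun y ↦ (inner ℝ ((Y + Y') y) (Z y) : ℝ)) =
      (fun y ↦ inner ℝ (Y y) (Z y)) + (fun y ↦ inner ℝ (Y' y) (Z y)) := by
    ext y; simp [inner_add_left]
  simp only [koszul, e1, e2, h1, h2, mlieBracket_add_left hY hY', mlieBracket_add_right hY hY']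
  simp [inner_add_left, inner_add_right]
  ring

theorem koszul_smul {f : M → ℝ} {X Y Z : Π x : M, TangentSpace I x} {x : M}
    (hf : MDiffAt f x) (hX : MDiffAt (T% X) x)
    (hY : MDiffAt (T% Y) x) (hZ : MDiffAt (T% Z) x) :
    koszul I X (f • Y) Z x
      = f x * koszul I X Y Z x + mvfderiv I f x (X x) * inner ℝ (Y x) (Z x) := by
  have h1 := mvfderiv_mul hf (mdifferentiableAt_inner I hX hY)
  have h2 := mvfderiv_mul hf (mdifferentiableAt_inner I hY hZ)
  have e1 : (fun y ↦ (inner ℝ (X y) ((f • Y) y) : ℝ)) = f * (fun y ↦ inner ℝ (X y) (Y y)) := by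
    ext y; simp [inner_smul_right]
  have e2 : (fun y ↦ (inner ℝ ((f • Y) y) (Z y) : ℝ)) = f * (fun y ↦ inner ℝ (Y y) (Z y)) := by
    ext y; simp [inner_smul_left]
  simp only [koszul, e1, e2, h1, h2, mlieBracket_smul_left hf hY, mlieBracket_smul_right hf hY]
  simp [inner_add_left, inner_smul_left, inner_smul_right, inner_neg_left, real_inner_comm]
  ring

/-- The Levi-Civita connection of the Riemannian metric on `M`; `leviCivita I Y x v` is
`(∇_v Y)(x)`. The two theorems below say that it is metric and torsion-free. -/
def leviCivita : CovariantDerivative I E (fun x : M ↦ TangentSpace I x) where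
  toFun := leviCivitaFun I
  isCovariantDerivativeOnUniv :=
    { add := by
        intro Y Y' x hY hY' _
        ext v
        refine ext_inner_right ℝ fun w ↦ ?_
        simp only [add_apply, inner_add_left, inner_leviCivitaFun]
        rw [koszulForm_apply_extend I hY, koszulForm_apply_extend I hY',
          koszulForm_apply_extend I (mdifferentiableAt_add_section hY hY')]
        exact koszul_add I (mdifferentiableAt_extend I E _) hY hY' (mdifferentiableAt_extend I E _)
      leibniz := by
        intro Y f x hY hf _
        ext v
        refine ext_inner_right ℝ fun w ↦ ?_
        simp only [add_apply, smul_apply, inner_add_left,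
          ContinuousLinearMap.smulRight_apply, real_inner_smul_left, inner_leviCivitaFun]
        rw [koszulForm_apply_extend I hY, koszulForm_apply_extend I (hf.smul_section hY),
          koszul_smul I hf (mdifferentiableAt_extend I E _) hY (mdifferentiableAt_extend I E _)]
        simp }

theorem inner_leviCivita {X Y Z : Π x : M, TangentSpace I x} {x : M} (hX : MDiffAt (T% X) x)
    (hY : MDiffAt (T% Y) x) (hZ : MDiffAt (T% Z) x) :
    inner ℝ (leviCivita I Y x (X x)) (Z x) = koszul I X Y Z x := by
  rw [← koszulForm_apply I hX hY hZ]
  exact inner_leviCivitaFun I Y x (X x) (Z x)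

theorem mvfderiv_inner_leviCivita {X Y Z : Π x : M, TangentSpace I x} {x : M}
    (hX : MDiffAt (T% X) x) (hY : MDiffAt (T% Y) x) (hZ : MDiffAt (T% Z) x) :
    mvfderiv I (fun y ↦ (inner ℝ (Y y) (Z y) : ℝ)) x (X x)
      = inner ℝ (leviCivita I Y x (X x)) (Z x) + inner ℝ (Y x) (leviCivita I Z x (X x)) := by
  have h : ∀ u v : TangentSpace I x, (inner ℝ u v : ℝ) = inner ℝ v u := fun u v ↦
    real_inner_comm _ _
  rw [h (Y x), inner_leviCivita I hX hY hZ, inner_leviCivita I hX hZ hY, koszul, koszul]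
  have e1 : (fun y ↦ (inner ℝ (Z y) (Y y) : ℝ)) = fun y ↦ inner ℝ (Y y) (Z y) := by
    ext y; exact real_inner_comm _ _
  rw [e1, mlieBracket_swap_apply (V := Z) (W := Y)]
  simp only [inner_neg_left]
  ring

theorem torsion_leviCivita : (leviCivita I (M := M)).torsion = 0 := by
  rw [CovariantDerivative.torsion_eq_zero_iff]
  intro X Y x hX hY
  refine ext_inner_right ℝ fun w ↦ ?_
  obtain ⟨Z, hZ, rfl⟩ : ∃ Z : Π x : M, TangentSpace I x, MDiffAt (T% Z) x ∧ Z x = w :=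
    ⟨extend E w, mdifferentiableAt_extend I E _, by simp⟩
  rw [inner_sub_left, inner_leviCivita I hX hY hZ, inner_leviCivita I hY hX hZ, koszul, koszul]
  have e1 : (fun y ↦ (inner ℝ (Y y) (X y) : ℝ)) = fun y ↦ inner ℝ (X y) (Y y) := by
    ext y; exact real_inner_comm _ _
  rw [e1, mlieBracket_swap_apply (V := Y) (W := X)]
  simp only [inner_neg_left]
  ring

end LeviCivita

/-! ### The pullback connection and the second fundamental form of a map -/

section Maps

variable {E : Type*} [NormedAddCommGroup E] [NormedSpace ℝ E] [FiniteDimensional ℝ E]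
  {H : Type*} [TopologicalSpace H] (I : ModelWithCorners ℝ E H)
  {M : Type*} [TopologicalSpace M] [ChartedSpace H M] [IsManifold I ∞ M]
  [RiemannianBundle (fun x : M ↦ TangentSpace I x)]
  [IsContMDiffRiemannianBundle I ∞ E (fun x : M ↦ TangentSpace I x)]
  {E' : Type*} [NormedAddCommGroup E'] [NormedSpace ℝ E'] [FiniteDimensional ℝ E']
  {H' : Type*} [TopologicalSpace H'] (J : ModelWithCorners ℝ E' H')
  {N : Type*} [TopologicalSpace N] [ChartedSpace H' N] [IsManifold J ∞ N]
  [RiemannianBundle (fun x : N ↦ TangentSpace J x)]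
  [IsContMDiffRiemannianBundle J ∞ E' (fun x : N ↦ TangentSpace J x)]

/-- The pullback `∇^F` of the Levi-Civita connection of `N` to the bundle `F⁻¹TN` over `M`, applied
to a section `s` in the direction `v ∈ T_x M`. In a local trivialization `e` of `TN` around `F x`,
with associated frame `e_i`, and for `s = ∑ cⁱ (e_i ∘ F)`, this is
`∑ dcⁱ(v) e_i (F x) + ∑ cⁱ(x) (∇_{F_* v} e_i) (F x)`. -/
def pullbackCov (F : M → N) (s : Π x : M, TangentSpace J (F x)) (x : M) (v : TangentSpace I x) :
    TangentSpace J (F x) :=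
  let e := trivializationAt E' (fun z : N ↦ TangentSpace J z) (F x)
  let c : M → E' := fun y ↦ e.continuousLinearMapAt ℝ (F y) (s y)
  e.symmL ℝ (F x) (mvfderiv I c x v)
    + leviCivita J (fun z ↦ e.symmL ℝ z (c x)) (F x) (mfderiv I J F x v)

theorem mdifferentiableAt_coord {Z : Π z : N, TangentSpace J z} {q : N} (hZ : MDiffAt (T% Z) q) :
    MDiffAt (fun y ↦ (trivializationAt E' (fun z : N ↦ TangentSpace J z) q).continuousLinearMapAt
      ℝ y (Z y)) q := by
  refine ((mdifferentiableAt_section J Z).1 hZ).congr_of_eventuallyEq ?_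
  filter_upwards [(trivializationAt E' (fun z : N ↦ TangentSpace J z) q).open_baseSet.mem_nhds
    (mem_baseSet_trivializationAt' q)] with y hy
  rw [Trivialization.continuousLinearMapAt_apply, Trivialization.linearMapAt_apply, if_pos hy]

theorem mdifferentiableAt_symmL (q : N) (u : E') :
    MDiffAt (T% (fun z ↦ (trivializationAt E' (fun z : N ↦ TangentSpace J z) q).symmL ℝ z u :
      Π z : N, TangentSpace J z)) q := by
  set e := trivializationAt E' (fun z : N ↦ TangentSpace J z) q
  have hq : q ∈ e.baseSet := mem_baseSet_trivializationAt' q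
  rw [mdifferentiableAt_section]
  refine (mdifferentiableAt_const (c := u)).congr_of_eventuallyEq ?_
  filter_upwards [e.open_baseSet.mem_nhds hq] with y hy
  have := e.continuousLinearMapAt_symmL (R := ℝ) hy u
  rwa [Trivialization.continuousLinearMapAt_apply, Trivialization.linearMapAt_apply,
    if_pos hy] at this

theorem leviCivita_eq_coord {Z : Π z : N, TangentSpace J z} {q : N} (hZ : MDiffAt (T% Z) q)
    (w : TangentSpace J q) :
    let e := trivializationAt E' (fun z : N ↦ TangentSpace J z) q
    let c : N → E' := fun y ↦ e.continuousLinearMapAt ℝ y (Z y)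
    leviCivita J Z q w
      = e.symmL ℝ q (mvfderiv J c q w) + leviCivita J (fun z ↦ e.symmL ℝ z (c q)) q w := by
  intro e c
  have hq : q ∈ e.baseSet := mem_baseSet_trivializationAt' q
  let D : (Π z : N, TangentSpace J z) → TangentSpace J q := fun Z ↦ leviCivita J Z q w
    - e.symmL ℝ q (mvfderiv J (fun y ↦ e.continuousLinearMapAt ℝ y (Z y)) q w)
    - leviCivita J (fun z ↦ e.symmL ℝ z (e.continuousLinearMapAt ℝ q (Z q))) q w
  have hcov := (leviCivita J (M := N)).isCovariantDerivativeOn (s := Set.univ)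
  have hD : TensorialAt J E' D q := by
    constructor
    · intro f Z hf hZ
      have e1 : (fun y ↦ e.continuousLinearMapAt ℝ y ((f • Z) y))
          = f • (fun y ↦ e.continuousLinearMapAt ℝ y (Z y)) := by
        ext y; simp
      have e2 : (fun z ↦ e.symmL ℝ z (e.continuousLinearMapAt ℝ q ((f • Z) q)))
          = f q • (fun z ↦ e.symmL ℝ z (e.continuousLinearMapAt ℝ q (Z q))) := by
        ext y; simp
      have h3 : mvfderiv J (f • (fun y ↦ e.continuousLinearMapAt ℝ y (Z y))) q w
          = f q • mvfderiv J (fun y ↦ e.continuousLinearMapAt ℝ y (Z y)) q w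
            + mvfderiv J f q w • e.continuousLinearMapAt ℝ q (Z q) := by
        rw [mvfderiv_smul hf (mdifferentiableAt_coord J hZ)]; rfl
      have h4 : leviCivita J
          (f q • (fun z ↦ e.symmL ℝ z (e.continuousLinearMapAt ℝ q (Z q)))) q w
          = f q • leviCivita J
            (fun z ↦ e.symmL ℝ z (e.continuousLinearMapAt ℝ q (Z q))) q w := by
        rw [hcov.smul_const (f q)
          (mdifferentiableAt_symmL J q (e.continuousLinearMapAt ℝ q (Z q)))]; rfl
      have h5 : leviCivita J (f • Z) q w = f q • leviCivita J Z q w + mvfderiv J f q w • Z q := by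
        rw [hcov.leibniz hZ hf]; rfl
      have h6 := e.symmL_continuousLinearMapAt (R := ℝ) hq (Z q)
      simp only [D, e1, e2, h3, h4, h5, map_add, map_smul, h6]
      module
    · intro Z Z' hZ hZ'
      have e1 : (fun y ↦ e.continuousLinearMapAt ℝ y ((Z + Z') y))
          = (fun y ↦ e.continuousLinearMapAt ℝ y (Z y))
            + (fun y ↦ e.continuousLinearMapAt ℝ y (Z' y)) := by
        ext y; simp
      have e2 : (fun z ↦ e.symmL ℝ z (e.continuousLinearMapAt ℝ q ((Z + Z') q)))
          = (fun z ↦ e.symmL ℝ z (e.continuousLinearMapAt ℝ q (Z q)))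
            + (fun z ↦ e.symmL ℝ z (e.continuousLinearMapAt ℝ q (Z' q))) := by
        ext y; simp
      have h3 : mvfderiv J ((fun y ↦ e.continuousLinearMapAt ℝ y (Z y))
            + (fun y ↦ e.continuousLinearMapAt ℝ y (Z' y))) q w
          = mvfderiv J (fun y ↦ e.continuousLinearMapAt ℝ y (Z y)) q w
            + mvfderiv J (fun y ↦ e.continuousLinearMapAt ℝ y (Z' y)) q w := by
        rw [mvfderiv_add (mdifferentiableAt_coord J hZ) (mdifferentiableAt_coord J hZ')]; rfl
      have h4 : leviCivita J ((fun z ↦ e.symmL ℝ z (e.continuousLinearMapAt ℝ q (Z q)))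
            + (fun z ↦ e.symmL ℝ z (e.continuousLinearMapAt ℝ q (Z' q)))) q w
          = leviCivita J (fun z ↦ e.symmL ℝ z (e.continuousLinearMapAt ℝ q (Z q))) q w
            + leviCivita J (fun z ↦ e.symmL ℝ z (e.continuousLinearMapAt ℝ q (Z' q))) q w := by
        rw [hcov.add (mdifferentiableAt_symmL J q (e.continuousLinearMapAt ℝ q (Z q)))
          (mdifferentiableAt_symmL J q (e.continuousLinearMapAt ℝ q (Z' q)))]; rfl
      have h5 : leviCivita J (Z + Z') q w = leviCivita J Z q w + leviCivita J Z' q w := by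
        rw [hcov.add hZ hZ']; rfl
      simp only [D, e1, e2, h3, h4, h5, map_add]
      module
  have h0 := hD.pointwise hZ (mdifferentiableAt_symmL J q (c q))
    (e.symmL_continuousLinearMapAt (R := ℝ) hq (Z q)).symm
  have h1 : D (fun z ↦ e.symmL ℝ z (c q)) = 0 := by
    have h2 : mvfderiv J (fun y ↦ e.continuousLinearMapAt ℝ y (e.symmL ℝ y (c q))) q = 0 := by
      rw [← mvfderiv_const (I := J) (M := N) (c q) (x := q)]
      have : (fun y ↦ e.continuousLinearMapAt ℝ y (e.symmL ℝ y (c q))) =ᶠ[𝓝 q] fun _ ↦ c q := by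
        filter_upwards [e.open_baseSet.mem_nhds hq] with y hy
        exact e.continuousLinearMapAt_symmL (R := ℝ) hy (c q)
      ext w
      simp only [mvfderiv, ContinuousLinearMap.comp_apply]
      exact congrArg (fun L : TangentSpace J q →L[ℝ] E' ↦ L w) this.mfderiv_eq
    simp only [D]
    rw [h2, e.continuousLinearMapAt_symmL (R := ℝ) hq (c q)]
    simp
  rw [h1] at h0
  simp only [D] at h0
  rw [← sub_eq_zero, ← h0]
  simp only [c]; abel

/-- On a section of the form `Z ∘ F`, the pullback connection is `∇_{F_* v} Z`. -/
theorem pullbackCov_comp {F : M → N} {Z : Π z : N, TangentSpace J z} {x : M}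
    (hF : MDiffAt F x) (hZ : MDiffAt (T% Z) (F x)) (v : TangentSpace I x) :
    pullbackCov I J F (fun y ↦ Z (F y)) x v = leviCivita J Z (F x) (mfderiv I J F x v) := by
  rw [leviCivita_eq_coord J hZ, pullbackCov]
  congr 2
  exact mfderiv_comp_apply x (mdifferentiableAt_coord J hZ) hF v

/-- The second fundamental form `(∇F_*)(X, Y) = ∇^F_X (F_* Y) - F_* (∇_X Y)` of `F`. -/
def secondFundamentalForm (F : M → N) (X Y : Π x : M, TangentSpace I x) (x : M) :
    TangentSpace J (F x) :=
  pullbackCov I J F (fun y ↦ mfderiv I J F y (Y y)) x (X x)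
    - mfderiv I J F x (leviCivita I Y x (X x))

/-- A smooth vector field. -/
def IsSmoothField (X : Π x : M, TangentSpace I x) : Prop :=
  ContMDiff I I.tangent ∞ (fun x ↦ (⟨x, X x⟩ : TangentBundle I M))

/-- The map `F` is totally geodesic: `∇F_* = 0`. -/
def IsTotallyGeodesicMap (F : M → N) : Prop :=
  ∀ X Y : Π x : M, TangentSpace I x, IsSmoothField I X → IsSmoothField I Y →
    ∀ x, secondFundamentalForm I J F X Y x = 0

/-! ### Riemannian submersions and their fundamental tensors -/

/-- The vertical space `ker F_*` at `x`; its orthogonal complement is the horizontal space. -/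
def verticalSpace (F : M → N) (x : M) : Submodule ℝ (TangentSpace I x) :=
  LinearMap.ker (mfderiv I J F x).toLinearMap

/-- A vertical vector field. -/
def IsVertical (F : M → N) (X : Π x : M, TangentSpace I x) : Prop :=
  ∀ x, X x ∈ verticalSpace I J F x

/-- A horizontal vector field. -/
def IsHorizontal (F : M → N) (X : Π x : M, TangentSpace I x) : Prop :=
  ∀ x, X x ∈ (verticalSpace I J F x)ᗮ

/-- A Riemannian submersion: a smooth map onto `N`, of maximal rank, whose differential preserves
the lengths of horizontal vectors. -/
structure IsRiemannianSubmersion (F : M → N) : Prop where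
  contMDiff : ContMDiff I J ∞ F
  surjective : Function.Surjective F
  surjective_mfderiv : ∀ x, Function.Surjective (mfderiv I J F x)
  norm_mfderiv : ∀ x, ∀ v ∈ (verticalSpace I J F x)ᗮ, ‖mfderiv I J F x v‖ = ‖v‖

/-- The vertical part `𝒱X` of a vector field. -/
def vertPart (F : M → N) (X : Π x : M, TangentSpace I x) (x : M) : TangentSpace I x :=
  (verticalSpace I J F x).starProjection (X x)

/-- The horizontal part `ℋX` of a vector field. -/
def horPart (F : M → N) (X : Π x : M, TangentSpace I x) (x : M) : TangentSpace I x :=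
  ((verticalSpace I J F x)ᗮ).starProjection (X x)

/-- The covariant derivative `∇_X Y` of vector fields. -/
def nabla (X Y : Π x : M, TangentSpace I x) (x : M) : TangentSpace I x :=
  leviCivita I Y x (X x)

/-- The tensor `𝒯_X Y = ℋ∇_{𝒱X} 𝒱Y + 𝒱∇_{𝒱X} ℋY`. -/
def tensorT (F : M → N) (X Y : Π x : M, TangentSpace I x) (x : M) : TangentSpace I x :=
  horPart I J F (nabla I (vertPart I J F X) (vertPart I J F Y)) x
    + vertPart I J F (nabla I (vertPart I J F X) (horPart I J F Y)) x

/-- The tensor `𝒜_X Y = 𝒱∇_{ℋX} ℋY + ℋ∇_{ℋX} 𝒱Y`. -/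
def tensorA (F : M → N) (X Y : Π x : M, TangentSpace I x) (x : M) : TangentSpace I x :=
  vertPart I J F (nabla I (horPart I J F X) (horPart I J F Y)) x
    + horPart I J F (nabla I (horPart I J F X) (vertPart I J F Y)) x

end Maps

/-! ### Sasakian structures -/

section Sasakian

variable {E : Type*} [NormedAddCommGroup E] [NormedSpace ℝ E] [FiniteDimensional ℝ E]
  {H : Type*} [TopologicalSpace H] (I : ModelWithCorners ℝ E H)
  (M : Type*) [TopologicalSpace M] [ChartedSpace H M] [IsManifold I ∞ M]
  [RiemannianBundle (fun x : M ↦ TangentSpace I x)]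
  [IsContMDiffRiemannianBundle I ∞ E (fun x : M ↦ TangentSpace I x)]

/-- An almost contact metric structure `(φ, ξ, η, g)` on `M`, where `g` is the given Riemannian
metric. -/
structure AlmostContactMetricStructure where
  /-- The tensor field of type `(1, 1)`. -/
  φ : Π x : M, TangentSpace I x →L[ℝ] TangentSpace I x
  /-- The characteristic vector field. -/
  ξ : Π x : M, TangentSpace I x
  /-- The 1-form. -/
  η : Π x : M, TangentSpace I x →L[ℝ] ℝ
  smooth_φ : ContMDiff I (I.prod 𝓘(ℝ, E →L[ℝ] E)) ∞
    (fun x ↦ TotalSpace.mk' (E →L[ℝ] E)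
      (E := fun x : M ↦ TangentSpace I x →L[ℝ] TangentSpace I x) x (φ x))
  smooth_ξ : IsSmoothField I ξ
  smooth_η : ContMDiff I (I.prod 𝓘(ℝ, E →L[ℝ] ℝ)) ∞
    (fun x ↦ TotalSpace.mk' (E →L[ℝ] ℝ) (E := fun x : M ↦ TangentSpace I x →L[ℝ] ℝ) x (η x))
  φ_φ : ∀ x v, φ x (φ x v) = -v + η x v • ξ x
  φ_ξ : ∀ x, φ x (ξ x) = 0
  η_φ : ∀ x v, η x (φ x v) = 0
  η_ξ : ∀ x, η x (ξ x) = 1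
  inner_φ_φ : ∀ x v w, (inner ℝ (φ x v) (φ x w) : ℝ) = inner ℝ v w - η x v * η x w
  η_eq_inner : ∀ x v, η x v = inner ℝ v (ξ x)

namespace AlmostContactMetricStructure

variable {I M} (S : AlmostContactMetricStructure I M)

/-- The vector field `φX`. -/
def phi (X : Π x : M, TangentSpace I x) (x : M) : TangentSpace I x := S.φ x (X x)

/-- The exterior derivative of `η`, with the normalization
`2 dη(X, Y) = X(η(Y)) - Y(η(X)) - η([X, Y])`. -/
def dη (X Y : Π x : M, TangentSpace I x) (x : M) : ℝ :=
  (1 / 2 : ℝ) * (mvfderiv I (fun y ↦ S.η y (Y y)) x (X x)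
    - mvfderiv I (fun y ↦ S.η y (X y)) x (Y x) - S.η x (mlieBracket I X Y x))

/-- The Nijenhuis tensor `φ²[X, Y] + [φX, φY] - φ[φX, Y] - φ[X, φY]` of `φ`. -/
def nijenhuis (X Y : Π x : M, TangentSpace I x) (x : M) : TangentSpace I x :=
  S.φ x (S.φ x (mlieBracket I X Y x)) + mlieBracket I (S.phi X) (S.phi Y) x
    - S.φ x (mlieBracket I (S.phi X) Y x) - S.φ x (mlieBracket I X (S.phi Y) x)

/-- The structure is Sasakian: it is a contact metric structure, `dη(X, Y) = g(X, φY)`, and it is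
normal, `N + 2 dη ⊗ ξ = 0`. -/
structure IsSasakian : Prop where
  contact : ∀ X Y : Π x : M, TangentSpace I x, IsSmoothField I X → IsSmoothField I Y →
    ∀ x, S.dη X Y x = inner ℝ (X x) (S.φ x (Y x))
  normal : ∀ X Y : Π x : M, TangentSpace I x, IsSmoothField I X → IsSmoothField I Y →
    ∀ x, S.nijenhuis X Y x + (2 * S.dη X Y x) • S.ξ x = 0

end AlmostContactMetricStructure

end Sasakian

section AntiInvariant

variable {E : Type*} [NormedAddCommGroup E] [NormedSpace ℝ E] [FiniteDimensional ℝ E]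
  {H : Type*} [TopologicalSpace H] {I : ModelWithCorners ℝ E H}
  {M : Type*} [TopologicalSpace M] [ChartedSpace H M] [IsManifold I ∞ M]
  [RiemannianBundle (fun x : M ↦ TangentSpace I x)]
  [IsContMDiffRiemannianBundle I ∞ E (fun x : M ↦ TangentSpace I x)]
  {E' : Type*} [NormedAddCommGroup E'] [NormedSpace ℝ E'] [FiniteDimensional ℝ E']
  {H' : Type*} [TopologicalSpace H'] (J : ModelWithCorners ℝ E' H')
  {N : Type*} [TopologicalSpace N] [ChartedSpace H' N] [IsManifold J ∞ N]
  [RiemannianBundle (fun x : N ↦ TangentSpace J x)]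
  [IsContMDiffRiemannianBundle J ∞ E' (fun x : N ↦ TangentSpace J x)]

/-- An anti-invariant Riemannian submersion from a Sasakian manifold: a Riemannian submersion `F`
with `φ (ker F_*) ⊆ (ker F_*)ᗮ`. -/
structure IsAntiInvariantSubmersion (S : AlmostContactMetricStructure I M) (F : M → N) : Prop where
  isSasakian : S.IsSasakian
  isRiemannianSubmersion : IsRiemannianSubmersion I J F
  anti_invariant : ∀ x, (verticalSpace I J F x).map (S.φ x).toLinearMap ≤ (verticalSpace I J F x)ᗮ

end AntiInvariant

end

end SasakianSubmersion

/-!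
The bilinear form `b = ∇F_*` is symmetric, since Levi-Civita connections are torsion free. As `F_*`
is isometric on horizontal vectors, `⟪b(v, h), F_* k⟫` is antisymmetric in the horizontal vectors
`h` and `k`; together with the symmetry of `b` this gives `b(h, k) = 0`. For a vertical vector `u`
and a horizontal field `Z` one has `⟪b(w, u), F_* Z⟫ = ⟪u, ∇_w Z⟫`, so the conditions on `𝒯` and `𝒜`
say that `b(w, u)` is orthogonal to `F_* φ(ker F_*)` for `w` vertical, respectively horizontal. What
remains is the component of `b(w, u)` along `F_* ξ`, and here the only property of `ξ` that matters
is that it is a Killing field; for a Sasakian structure this holds because the Lie derivatives of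
`dη = g(·, φ·)`, `φ` and `η` along `ξ` vanish. For vertical `w` the number
`⟪b(w, u), F_* ξ⟫ = ⟪u, ∇_w ξ⟫` is both symmetric and antisymmetric in `u` and `w`. For horizontal
`w` it equals `-⟪b(ξ, u), F_* w⟫`, and `b(ξ, u) = 0`: it is orthogonal to `F_* φ(ker F_*)` by the
condition on `𝒜`, and to `F_* ξ` by antisymmetry.
-/

namespace SasakianSubmersion

open Bundle VectorField FiberBundle

noncomputable section

section ChartField

variable {E : Type*} [NormedAddCommGroup E] [NormedSpace ℝ E]
  {H : Type*} [TopologicalSpace H] {I : ModelWithCorners ℝ E H}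
  {M : Type*} [TopologicalSpace M] [ChartedSpace H M]
  {G : Type*} [NormedAddCommGroup G] [NormedSpace ℝ G] {x : M} {f : M → G}

theorem mvfderiv_congr {g : M → G} (h : f =ᶠ[𝓝 x] g) : mvfderiv I f x = mvfderiv I g x := by
  ext v
  exact congrArg (fun L : E →L[ℝ] G ↦ L v) h.mfderiv_eq

variable (I) in
/-- The vector field `X` read in the preferred chart at `x`, as a map on the model space. -/
def chartField (x : M) (X : Π y : M, TangentSpace I y) : E → E :=
  mpullback 𝓘(ℝ, E) I (extChartAt I x).symm X

variable [I.Boundaryless]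

theorem contDiffAt_comp_extChartAt_symm {n : WithTop ℕ∞} (hf : CMDiffAt n f x) :
    ContDiffAt ℝ n (f ∘ (extChartAt I x).symm) (extChartAt I x x) := by
  have h := (contMDiffAt_iff.1 hf).2
  rw [I.range_eq_univ, contDiffWithinAt_univ] at h
  simpa using! h

variable [IsManifold I 1 M]

theorem fderiv_comp_extChartAt_symm {z : E} (hz : z ∈ (extChartAt I x).target)
    (hf : MDiffAt f ((extChartAt I x).symm z)) :
    fderiv ℝ (f ∘ (extChartAt I x).symm) z
      = (mvfderiv I f ((extChartAt I x).symm z)).comp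
        (mfderiv 𝓘(ℝ, E) I (extChartAt I x).symm z) := by
  have hs := mdifferentiableWithinAt_extChartAt_symm (I := I) hz
  rw [I.range_eq_univ, mdifferentiableWithinAt_univ] at hs
  rw [← mfderiv_eq_fderiv]
  exact mfderiv_comp z hf hs

theorem mvfderiv_eq_fderiv_chartField (X : Π y : M, TangentSpace I y) {y : M}
    (hy : y ∈ (extChartAt I x).source) (hf : MDiffAt f y) :
    mvfderiv I f y (X y) = fderiv ℝ (f ∘ (extChartAt I x).symm) (extChartAt I x y)
      (chartField I x X (extChartAt I x y)) := by
  suffices h : ∀ z ∈ (extChartAt I x).target, MDiffAt f ((extChartAt I x).symm z) →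
      mvfderiv I f ((extChartAt I x).symm z) (X ((extChartAt I x).symm z))
        = fderiv ℝ (f ∘ (extChartAt I x).symm) z (chartField I x X z) by
    have h' := h _ ((extChartAt I x).map_source hy)
    rw [(extChartAt I x).left_inv hy] at h'
    exact h' hf
  intro z hz hf
  have hinv := isInvertible_mfderivWithin_extChartAt_symm (I := I) hz
  rw [I.range_eq_univ, mfderivWithin_univ] at hinv
  rw [fderiv_comp_extChartAt_symm hz hf]
  exact congrArg (mvfderiv I f _) (hinv.self_apply_inverse _).symm

theorem eventually_mvfderiv_eq_fderiv_chartField (hf : CMDiffAt 1 f x)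
    (X : Π y : M, TangentSpace I y) :
    ∀ᶠ y in 𝓝 x, mvfderiv I f y (X y) = fderiv ℝ (f ∘ (extChartAt I x).symm) (extChartAt I x y)
      (chartField I x X (extChartAt I x y)) := by
  filter_upwards [extChartAt_source_mem_nhds (I := I) x,
    (contMDiffAt_iff_contMDiffAt_nhds (by simp)).1 hf] with y hy hfy
  exact mvfderiv_eq_fderiv_chartField X hy (hfy.mdifferentiableAt one_ne_zero)

theorem chartField_self (x : M) (X : Π y : M, TangentSpace I y) :
    chartField I x X (extChartAt I x x) = X x := by
  have h := mfderivWithin_extChartAt_symm_inverse_apply (I := I) (x := x)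
  rw [I.range_eq_univ, mfderivWithin_univ] at h
  exact (congrArg _ (congrArg (fun y ↦ (X y : E)) (extChartAt_to_inv x))).trans (h (X x))

theorem mlieBracket_eq_lieBracket_chartField (X Y : Π y : M, TangentSpace I y) :
    mlieBracket I X Y x
      = lieBracket ℝ (chartField I x X) (chartField I x Y) (extChartAt I x x) := by
  rw [mlieBracket, mlieBracketWithin_apply, I.range_eq_univ, Set.preimage_univ, Set.univ_inter,
    mfderiv_extChartAt_self, mpullbackWithin_univ, mpullbackWithin_univ]
  exact (congrArg (fun L : E →L[ℝ] E ↦ L (lieBracketWithin ℝ (chartField I x X)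
    (chartField I x Y) Set.univ (extChartAt I x x))) ContinuousLinearMap.inverse_id).trans
      (congrFun lieBracketWithin_univ _)

end ChartField

section LieBracket

variable {E : Type*} [NormedAddCommGroup E] [NormedSpace ℝ E] [CompleteSpace E]
  {H : Type*} [TopologicalSpace H] {I : ModelWithCorners ℝ E H} [I.Boundaryless]
  {M : Type*} [TopologicalSpace M] [ChartedSpace H M] [IsManifold I 2 M]
  {G : Type*} [NormedAddCommGroup G] [NormedSpace ℝ G] {x : M} {f : M → G}
  {X Y : Π y : M, TangentSpace I y}

theorem differentiableAt_chartField (hX : MDiffAt (T% X) x) :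
    DifferentiableAt ℝ (chartField I x X) (extChartAt I x x) := by
  have := hX.mdifferentiableWithinAt (s := Set.univ)
    |>.differentiableWithinAt_mpullbackWithin_vectorField
  rw [I.range_eq_univ, Set.preimage_univ, Set.univ_inter, mpullbackWithin_univ] at this
  exact differentiableWithinAt_univ.1 this

theorem mdifferentiableAt_mvfderiv (hf : CMDiffAt 2 f x) (hX : MDiffAt (T% X) x) :
    MDiffAt (fun y ↦ mvfderiv I f y (X y)) x := by
  have h : DifferentiableAt ℝ
      (fun z ↦ fderiv ℝ (f ∘ (extChartAt I x).symm) z (chartField I x X z)) (extChartAt I x x) :=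
    (((contDiffAt_comp_extChartAt_symm hf).fderiv_right (m := 1) (by norm_num)).differentiableAt
      one_ne_zero).clm_apply (differentiableAt_chartField hX)
  exact (h.comp_mdifferentiableAt (mdifferentiableAt_extChartAt (mem_chart_source H x)))
    |>.congr_of_eventuallyEq
      (eventually_mvfderiv_eq_fderiv_chartField (hf.of_le one_le_two) X)

theorem mvfderiv_mvfderiv (hf : CMDiffAt 2 f x) (hX : MDiffAt (T% X) x)
    (Y : Π y : M, TangentSpace I y) :
    mvfderiv I (fun y ↦ mvfderiv I f y (X y)) x (Y x)
      = fderiv ℝ (fun z ↦ fderiv ℝ (f ∘ (extChartAt I x).symm) z (chartField I x X z))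
        (extChartAt I x x) (chartField I x Y (extChartAt I x x)) := by
  rw [mvfderiv_eq_fderiv_chartField Y (mem_extChartAt_source x) (mdifferentiableAt_mvfderiv hf hX)]
  congr 1
  apply Filter.EventuallyEq.fderiv_eq
  have hsymm : Filter.Tendsto (extChartAt I x).symm (𝓝 (extChartAt I x x)) (𝓝 x) := by
    simpa [ContinuousAt] using! continuousAt_extChartAt_symm (I := I) x
  filter_upwards [extChartAt_target_mem_nhds x, hsymm.eventually
    (eventually_mvfderiv_eq_fderiv_chartField (hf.of_le one_le_two) X)] with z hzt hz
  rw [Function.comp_apply, hz, (extChartAt I x).right_inv hzt]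

theorem mvfderiv_mlieBracket (hf : CMDiffAt 2 f x) (hX : MDiffAt (T% X) x)
    (hY : MDiffAt (T% Y) x) :
    mvfderiv I f x (mlieBracket I X Y x)
      = mvfderiv I (fun y ↦ mvfderiv I f y (Y y)) x (X x)
        - mvfderiv I (fun y ↦ mvfderiv I f y (X y)) x (Y x) := by
  rw [mvfderiv_mvfderiv hf hX, mvfderiv_mvfderiv hf hY,
    ← fderiv_apply_lieBracket (contDiffAt_comp_extChartAt_symm hf) (by simp)
      (differentiableAt_chartField hY) (differentiableAt_chartField hX),
    mvfderiv_eq_fderiv_chartField _ (mem_extChartAt_source x)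
      (hf.mdifferentiableAt two_ne_zero), chartField_self, mlieBracket_eq_lieBracket_chartField]

end LieBracket

section CoordField

variable {E : Type*} [NormedAddCommGroup E] [NormedSpace ℝ E]
  {H : Type*} [TopologicalSpace H] {I : ModelWithCorners ℝ E H}
  {M : Type*} [TopologicalSpace M] [ChartedSpace H M] [IsManifold I 1 M]
  {G : Type*} [NormedAddCommGroup G] [NormedSpace ℝ G] {x y : M}

variable (I) in
/-- The coordinate vector field of the preferred chart at `x` with constant coordinates `u`. It is
used only near `x`: its values away from the chart domain are junk. -/
def coordField (x : M) (u : E) (y : M) : TangentSpace I y :=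
  (trivializationAt E (fun y : M ↦ TangentSpace I y) x).symmL ℝ y u

theorem coordField_self (x : M) (v : TangentSpace I x) : coordField I x v x = v := by
  have h := Trivialization.symmL_continuousLinearMapAt (R := ℝ)
    (trivializationAt E (fun y : M ↦ TangentSpace I y) x) (mem_baseSet_trivializationAt' x) v
  rw [TangentBundle.continuousLinearMapAt_trivializationAt (mem_chart_source H x),
    mfderiv_extChartAt_self] at h
  exact h

theorem coordField_add (x : M) (u v : E) :
    coordField I x (u + v) = coordField I x u + coordField I x v :=
  funext fun _ ↦ map_add _ _ _

theorem coordField_smul (x : M) (c : ℝ) (u : E) :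
    coordField I x (c • u) = c • coordField I x u :=
  funext fun _ ↦ map_smul _ _ _

theorem contMDiffOn_coordField {n : WithTop ℕ∞}
    [ContMDiffVectorBundle n E (fun y : M ↦ TangentSpace I y) I] {U : Set M}
    (hU : IsOpen U) (hUx : U ⊆ (chartAt H x).source) {u : M → E} (hu : CMDiff[U] n u) :
    CMDiff[U] n (T% (fun y ↦ coordField I x (u y) y)) := by
  rw [Trivialization.contMDiffOn_section_iff
    (e := trivializationAt E (fun y : M ↦ TangentSpace I y) x) hU hUx]
  refine hu.congr fun y hy ↦ ?_
  have h := Trivialization.continuousLinearMapAt_symmL (R := ℝ)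
    (trivializationAt E (fun z : M ↦ TangentSpace I z) x) (hUx hy) (u y)
  rwa [Trivialization.continuousLinearMapAt_apply, Trivialization.linearMapAt_apply,
    if_pos (show y ∈ (trivializationAt E (fun z : M ↦ TangentSpace I z) x).baseSet from hUx hy)]
    at h

theorem mdifferentiableAt_coordField [ContMDiffVectorBundle 1 E (fun y : M ↦ TangentSpace I y) I]
    (x : M) (u : E) : MDiffAt (T% (coordField I x u)) x :=
  (((contMDiffOn_coordField (chartAt H x).open_source subset_rfl contMDiffOn_const).contMDiffAt
    (chart_source_mem_nhds H x)).mdifferentiableAt one_ne_zero)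

theorem coordField_extChartAt_symm [I.Boundaryless] {z : E} (hz : z ∈ (extChartAt I x).target)
    (u : E) : coordField I x u ((extChartAt I x).symm z)
      = mfderiv 𝓘(ℝ, E) I (extChartAt I x).symm z u := by
  have h := TangentBundle.symmL_trivializationAt (I := I) (x₀ := x)
    (x := (extChartAt I x).symm z) (by simpa using (extChartAt I x).map_target hz)
  rw [I.range_eq_univ, mfderivWithin_univ] at h
  refine (congrArg (fun L : E →L[ℝ] E ↦ L u) h).trans ?_
  exact congrArg (fun z : E ↦ (mfderiv 𝓘(ℝ, E) I (extChartAt I x).symm z : E →L[ℝ] E) u)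
    ((extChartAt I x).right_inv hz)

variable [I.Boundaryless]

theorem chartField_coordField {z : E} (hz : z ∈ (extChartAt I x).target) (u : E) :
    chartField I x (coordField I x u) z = u := by
  have hinv := isInvertible_mfderivWithin_extChartAt_symm (I := I) hz
  rw [I.range_eq_univ, mfderivWithin_univ] at hinv
  exact (congrArg _ (coordField_extChartAt_symm hz u)).trans (hinv.inverse_apply_self u)

theorem mvfderiv_coordField {f : M → G} (hy : y ∈ (extChartAt I x).source) (hf : MDiffAt f y)
    (u : E) : mvfderiv I f y (coordField I x u y)
      = fderiv ℝ (f ∘ (extChartAt I x).symm) (extChartAt I x y) u := by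
  rw [mvfderiv_eq_fderiv_chartField _ hy hf,
    chartField_coordField ((extChartAt I x).map_source hy)]

theorem mlieBracket_coordField (x : M) (u v : E) :
    mlieBracket I (coordField I x u) (coordField I x v) x = 0 := by
  have h : ∀ u, chartField I x (coordField I x u) =ᶠ[𝓝 (extChartAt I x x)] fun _ ↦ u := by
    intro u
    filter_upwards [extChartAt_target_mem_nhds x] with z hz using chartField_coordField hz u
  rw [mlieBracket_eq_lieBracket_chartField, (h u).lieBracket_vectorField_eq (h v)]
  simp [lieBracket]
  rfl

end CoordField

section SmoothField

variable {E : Type*} [NormedAddCommGroup E] [NormedSpace ℝ E]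
  {H : Type*} [TopologicalSpace H] {I : ModelWithCorners ℝ E H}
  {M : Type*} [TopologicalSpace M] [ChartedSpace H M] [IsManifold I ∞ M]
  {X : Π x : M, TangentSpace I x}

theorem IsSmoothField.mdifferentiableAt (hX : IsSmoothField I X) (x : M) : MDiffAt (T% X) x :=
  ContMDiffAt.mdifferentiableAt (ContMDiff.contMDiffAt hX) (by simp)

end SmoothField

section LeviCivita

variable {E : Type*} [NormedAddCommGroup E] [NormedSpace ℝ E] [FiniteDimensional ℝ E]
  {H : Type*} [TopologicalSpace H] {I : ModelWithCorners ℝ E H}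
  {M : Type*} [TopologicalSpace M] [ChartedSpace H M] [IsManifold I ∞ M]
  [RiemannianBundle (fun x : M ↦ TangentSpace I x)]
  [IsContMDiffRiemannianBundle I ∞ E (fun x : M ↦ TangentSpace I x)]
  {X Y : Π x : M, TangentSpace I x} {x : M}

theorem leviCivita_add_apply (hX : MDiffAt (T% X) x) (hY : MDiffAt (T% Y) x)
    (v : TangentSpace I x) :
    leviCivita I (X + Y) x v = leviCivita I X x v + leviCivita I Y x v := by
  rw [(leviCivita I (M := M)).isCovariantDerivativeOn.add hX hY]
  rfl

theorem leviCivita_smul_apply {f : M → ℝ} (hf : MDiffAt f x) (hX : MDiffAt (T% X) x)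
    (v : TangentSpace I x) :
    leviCivita I (f • X) x v = f x • leviCivita I X x v + mvfderiv I f x v • X x := by
  rw [(leviCivita I (M := M)).isCovariantDerivativeOn.leibniz hX hf]
  rfl

theorem leviCivita_const_smul_apply (c : ℝ) (hX : MDiffAt (T% X) x) (v : TangentSpace I x) :
    leviCivita I (c • X) x v = c • leviCivita I X x v := by
  rw [(leviCivita I (M := M)).isCovariantDerivativeOn.smul_const c hX]
  rfl

theorem leviCivita_sub_leviCivita (hX : MDiffAt (T% X) x) (hY : MDiffAt (T% Y) x) :
    leviCivita I Y x (X x) - leviCivita I X x (Y x) = mlieBracket I X Y x :=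
  (CovariantDerivative.torsion_eq_zero_iff (cov := leviCivita I (M := M))).1
    (torsion_leviCivita I) hX hY

theorem leviCivita_coordField_comm [I.Boundaryless] (x : M) (u v : E) :
    leviCivita I (coordField I x u) x (coordField I x v x)
      = leviCivita I (coordField I x v) x (coordField I x u x) := by
  rw [← sub_eq_zero, leviCivita_sub_leviCivita (mdifferentiableAt_coordField x v)
    (mdifferentiableAt_coordField x u), mlieBracket_coordField]

end LeviCivita

section PullbackConnection

variable {E : Type*} [NormedAddCommGroup E] [NormedSpace ℝ E]
  {H : Type*} [TopologicalSpace H] {I : ModelWithCorners ℝ E H}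
  {M : Type*} {E' : Type*} [NormedAddCommGroup E'] [NormedSpace ℝ E']
  {H' : Type*} [TopologicalSpace H'] {J : ModelWithCorners ℝ E' H'}
  {N : Type*} [TopologicalSpace N] [ChartedSpace H' N] {F : M → N} {x : M}
  {s t : Π y : M, TangentSpace J (F y)}

variable (J) in
/-- The coordinates, in the preferred chart of `N` at `F x`, of a section `s` of `F⁻¹TN`. They are
meaningful only near `x`. -/
def pullbackCoord [IsManifold J 1 N] (F : M → N) (x : M) (s : Π y : M, TangentSpace J (F y))
    (y : M) : E' :=
  (trivializationAt E' (fun z : N ↦ TangentSpace J z) (F x)).continuousLinearMapAt ℝ (F y) (s y)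

theorem coordField_pullbackCoord [IsManifold J 1 N] {y : M}
    (hy : F y ∈ (chartAt H' (F x)).source) (s : Π y : M, TangentSpace J (F y)) :
    coordField J (F x) (pullbackCoord J F x s y) (F y) = s y :=
  Trivialization.symmL_continuousLinearMapAt (R := ℝ) _ hy _

variable [TopologicalSpace M] [ChartedSpace H M]

theorem contMDiffAt_extChartAt_comp {n : WithTop ℕ∞} [IsManifold J n N]
    (hF : CMDiffAt n F x) : CMDiffAt n (extChartAt J (F x) ∘ F) x :=
  contMDiffAt_extChartAt.comp x hF

theorem pullbackCoord_mfderiv [IsManifold J 1 N] {y : M} (hF : MDiffAt F y)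
    (hy : F y ∈ (chartAt H' (F x)).source) (Y : Π y : M, TangentSpace I y) :
    pullbackCoord J F x (fun y ↦ mfderiv I J F y (Y y)) y
      = mvfderiv I (extChartAt J (F x) ∘ F) y (Y y) := by
  rw [pullbackCoord, TangentBundle.continuousLinearMapAt_trivializationAt hy]
  exact (mfderiv_comp_apply y (mdifferentiableAt_extChartAt hy) hF _).symm

theorem pullbackCoord_mfderiv_eventuallyEq [IsManifold J 1 N] (hF : MDiff F) (x : M)
    (Y : Π y : M, TangentSpace I y) :
    pullbackCoord J F x (fun y ↦ mfderiv I J F y (Y y))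
      =ᶠ[𝓝 x] fun y ↦ mvfderiv I (extChartAt J (F x) ∘ F) y (Y y) := by
  filter_upwards [hF.continuous.continuousAt.preimage_mem_nhds (chart_source_mem_nhds H' (F x))]
    with y hy using pullbackCoord_mfderiv (hF y) hy Y

variable [FiniteDimensional ℝ E'] [IsManifold J ∞ N]
  [RiemannianBundle (fun x : N ↦ TangentSpace J x)]
  [IsContMDiffRiemannianBundle J ∞ E' (fun x : N ↦ TangentSpace J x)]

theorem pullbackCov_eq (s : Π y : M, TangentSpace J (F y)) (v : TangentSpace I x) :
    pullbackCov I J F s x v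
      = coordField J (F x) (mvfderiv I (pullbackCoord J F x s) x v) (F x)
        + leviCivita J (coordField J (F x) (pullbackCoord J F x s x)) (F x)
          (mfderiv I J F x v) := rfl

theorem pullbackCov_add (hs : MDiffAt (pullbackCoord J F x s) x)
    (ht : MDiffAt (pullbackCoord J F x t) x) (v : TangentSpace I x) :
    pullbackCov I J F (s + t) x v = pullbackCov I J F s x v + pullbackCov I J F t x v := by
  have hcoord : pullbackCoord J F x (s + t) = pullbackCoord J F x s + pullbackCoord J F x t :=
    funext fun _ ↦ map_add _ _ _
  have hderiv : mvfderiv I (pullbackCoord J F x s + pullbackCoord J F x t) x v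
      = mvfderiv I (pullbackCoord J F x s) x v + mvfderiv I (pullbackCoord J F x t) x v := by
    rw [mvfderiv_add hs ht]
    rfl
  simp only [pullbackCov_eq, hcoord, hderiv, Pi.add_apply, coordField_add]
  rw [leviCivita_add_apply (mdifferentiableAt_coordField _ _) (mdifferentiableAt_coordField _ _)]
  abel

theorem pullbackCov_smul {f : M → ℝ} (hf : MDiffAt f x) (hs : MDiffAt (pullbackCoord J F x s) x)
    (v : TangentSpace I x) :
    pullbackCov I J F (f • s) x v
      = f x • pullbackCov I J F s x v + mvfderiv I f x v • s x := by
  have hcoord : pullbackCoord J F x (f • s) = f • pullbackCoord J F x s :=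
    funext fun _ ↦ map_smul _ _ _
  have hderiv : mvfderiv I (f • pullbackCoord J F x s) x v
      = f x • mvfderiv I (pullbackCoord J F x s) x v
        + mvfderiv I f x v • pullbackCoord J F x s x := by
    rw [mvfderiv_smul hf hs]
    rfl
  simp only [pullbackCov_eq, hcoord, hderiv, Pi.add_apply, Pi.smul_apply, Pi.smul_apply',
    coordField_add, coordField_smul, coordField_pullbackCoord (mem_chart_source H' (F x))]
  rw [leviCivita_const_smul_apply _ (mdifferentiableAt_coordField _ _)]
  module

theorem pullbackCov_congr (h : ∀ᶠ y in 𝓝 x, s y = t y) (v : TangentSpace I x) :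
    pullbackCov I J F s x v = pullbackCov I J F t x v := by
  have hcoord : pullbackCoord J F x s =ᶠ[𝓝 x] pullbackCoord J F x t :=
    h.mono fun y hy ↦ congrArg _ hy
  rw [pullbackCov_eq, pullbackCov_eq, mvfderiv_congr hcoord, hcoord.self_of_nhds]

end PullbackConnection

section Torsion

variable {E : Type*} [NormedAddCommGroup E] [NormedSpace ℝ E] [FiniteDimensional ℝ E]
  {H : Type*} [TopologicalSpace H] {I : ModelWithCorners ℝ E H} [I.Boundaryless]
  {M : Type*} [TopologicalSpace M] [ChartedSpace H M] [IsManifold I ∞ M]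
  {E' : Type*} [NormedAddCommGroup E'] [NormedSpace ℝ E']
  {H' : Type*} [TopologicalSpace H'] {J : ModelWithCorners ℝ E' H'}
  {N : Type*} [TopologicalSpace N] [ChartedSpace H' N] [IsManifold J ∞ N]
  {F : M → N} {x : M} {X Y : Π x : M, TangentSpace I x}

theorem mdifferentiableAt_pullbackCoord_mfderiv (hF : ContMDiff I J ∞ F) (hY : MDiffAt (T% Y) x) :
    MDiffAt (pullbackCoord J F x (fun y ↦ mfderiv I J F y (Y y))) x :=
  (mdifferentiableAt_mvfderiv ((contMDiffAt_extChartAt_comp hF.contMDiffAt).of_le ENat.LEInfty.out)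
    hY).congr_of_eventuallyEq
      (pullbackCoord_mfderiv_eventuallyEq (hF.mdifferentiable (by simp)) x Y)

variable [FiniteDimensional ℝ E'] [J.Boundaryless]
  [RiemannianBundle (fun x : N ↦ TangentSpace J x)]
  [IsContMDiffRiemannianBundle J ∞ E' (fun x : N ↦ TangentSpace J x)]

theorem pullbackCov_mfderiv_sub_pullbackCov_mfderiv (hF : ContMDiff I J ∞ F)
    (hX : MDiffAt (T% X) x) (hY : MDiffAt (T% Y) x) :
    pullbackCov I J F (fun y ↦ mfderiv I J F y (Y y)) x (X x)
        - pullbackCov I J F (fun y ↦ mfderiv I J F y (X y)) x (Y x)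
      = mfderiv I J F x (mlieBracket I X Y x) := by
  have hFd : MDiff F := hF.mdifferentiable (by simp)
  have hcoord := fun Z ↦ pullbackCoord_mfderiv_eventuallyEq (J := J) hFd x Z
  have hpush := fun Z : Π x : M, TangentSpace I x ↦
    coordField_pullbackCoord (mem_chart_source H' (F x)) (fun y ↦ mfderiv I J F y (Z y))
  have hbracket := (hcoord _).self_of_nhds.trans (mvfderiv_mlieBracket
    ((contMDiffAt_extChartAt_comp hF.contMDiffAt).of_le ENat.LEInfty.out) hX hY)
  have hsymm := leviCivita_coordField_comm (I := J) (F x)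
    (pullbackCoord J F x (fun y ↦ mfderiv I J F y (Y y)) x)
    (pullbackCoord J F x (fun y ↦ mfderiv I J F y (X y)) x)
  rw [hpush, hpush] at hsymm
  rw [pullbackCov_eq, pullbackCov_eq, hsymm, add_sub_add_right_eq_sub, mvfderiv_congr (hcoord X),
    mvfderiv_congr (hcoord Y), ← hpush, hbracket]
  exact (map_sub _ _ _).symm

end Torsion

section SecondFundamentalForm

variable {E : Type*} [NormedAddCommGroup E] [NormedSpace ℝ E] [FiniteDimensional ℝ E]
  {H : Type*} [TopologicalSpace H] {I : ModelWithCorners ℝ E H}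
  {M : Type*} [TopologicalSpace M] [ChartedSpace H M] [IsManifold I ∞ M]
  [RiemannianBundle (fun x : M ↦ TangentSpace I x)]
  [IsContMDiffRiemannianBundle I ∞ E (fun x : M ↦ TangentSpace I x)]
  {E' : Type*} [NormedAddCommGroup E'] [NormedSpace ℝ E'] [FiniteDimensional ℝ E']
  {H' : Type*} [TopologicalSpace H'] {J : ModelWithCorners ℝ E' H'}
  {N : Type*} [TopologicalSpace N] [ChartedSpace H' N] [IsManifold J ∞ N]
  [RiemannianBundle (fun x : N ↦ TangentSpace J x)]
  [IsContMDiffRiemannianBundle J ∞ E' (fun x : N ↦ TangentSpace J x)]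
  {F : M → N} {x : M} {X Y : Π x : M, TangentSpace I x}

theorem tensorialAt_secondFundamentalForm_left (F : M → N) (x : M)
    (Y : Π y : M, TangentSpace I y) :
    TensorialAt I E (fun X ↦ secondFundamentalForm I J F X Y x) x where
  smul _ _ := by
    simp only [secondFundamentalForm, pullbackCov, Pi.smul_apply', map_smul]
    module
  add _ _ := by
    simp only [secondFundamentalForm, pullbackCov, Pi.add_apply, map_add]
    abel

variable [I.Boundaryless]

theorem tensorialAt_secondFundamentalForm_right (hF : ContMDiff I J ∞ F) (x : M)
    (X : Π y : M, TangentSpace I y) :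
    TensorialAt I E (fun Y ↦ secondFundamentalForm I J F X Y x) x where
  smul {f Y} hf hY := by
    have hpush : (fun y ↦ mfderiv I J F y ((f • Y) y)) = f • fun y ↦ mfderiv I J F y (Y y) :=
      funext fun _ ↦ map_smul _ _ _
    rw [secondFundamentalForm, secondFundamentalForm, hpush,
      pullbackCov_smul hf (mdifferentiableAt_pullbackCoord_mfderiv hF hY),
      leviCivita_smul_apply hf hY, map_add, map_smul, map_smul]
    module
  add {Y Y'} hY hY' := by
    have hpush : (fun y ↦ mfderiv I J F y ((Y + Y') y))
        = (fun y ↦ mfderiv I J F y (Y y)) + fun y ↦ mfderiv I J F y (Y' y) :=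
      funext fun _ ↦ map_add _ _ _
    rw [secondFundamentalForm, secondFundamentalForm, secondFundamentalForm, hpush,
      pullbackCov_add (mdifferentiableAt_pullbackCoord_mfderiv hF hY)
        (mdifferentiableAt_pullbackCoord_mfderiv hF hY'),
      leviCivita_add_apply hY hY', map_add]
    abel

/-- The second fundamental form of `F` at the point `x`, as a bilinear map on `T_x M`; the form
`secondFundamentalForm` on vector fields is tensorial in both arguments. -/
def secondFundamentalFormAt (hF : ContMDiff I J ∞ F) (x : M) :
    TangentSpace I x →L[ℝ] TangentSpace I x →L[ℝ] TangentSpace J (F x) :=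
  TensorialAt.mkHom₂ (fun X Y ↦ secondFundamentalForm I J F X Y x) x
    (fun Y _ ↦ tensorialAt_secondFundamentalForm_left F x Y)
    (fun X _ ↦ tensorialAt_secondFundamentalForm_right hF x X)

theorem secondFundamentalFormAt_apply (hF : ContMDiff I J ∞ F) (hY : MDiffAt (T% Y) x)
    (w : TangentSpace I x) :
    secondFundamentalFormAt hF x w (Y x)
      = pullbackCov I J F (fun y ↦ mfderiv I J F y (Y y)) x w
        - mfderiv I J F x (leviCivita I Y x w) := by
  have h := TensorialAt.mkHom₂_apply (fun Y _ ↦ tensorialAt_secondFundamentalForm_left F x Y)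
    (fun X _ ↦ tensorialAt_secondFundamentalForm_right hF x X)
    (mdifferentiableAt_extend I E w) hY
  simpa only [extend_apply_self, secondFundamentalForm] using! h

theorem secondFundamentalFormAt_of_related (hF : ContMDiff I J ∞ F) (hY : MDiffAt (T% Y) x)
    {Q : Π q : N, TangentSpace J q} (hQ : MDiffAt (T% Q) (F x))
    (hYQ : ∀ᶠ y in 𝓝 x, mfderiv I J F y (Y y) = Q (F y)) (w : TangentSpace I x) :
    secondFundamentalFormAt hF x w (Y x)
      = leviCivita J Q (F x) (mfderiv I J F x w) - mfderiv I J F x (leviCivita I Y x w) := by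
  rw [secondFundamentalFormAt_apply hF hY, pullbackCov_congr hYQ,
    pullbackCov_comp I J (hF.mdifferentiable (by simp) x) hQ]

variable [J.Boundaryless]

theorem secondFundamentalForm_comm (hF : ContMDiff I J ∞ F) (hX : MDiffAt (T% X) x)
    (hY : MDiffAt (T% Y) x) :
    secondFundamentalForm I J F X Y x = secondFundamentalForm I J F Y X x := by
  rw [← sub_eq_zero, secondFundamentalForm, secondFundamentalForm, sub_sub_sub_comm,
    pullbackCov_mfderiv_sub_pullbackCov_mfderiv hF hX hY, ← map_sub,
    leviCivita_sub_leviCivita hX hY, sub_self]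

theorem secondFundamentalFormAt_comm (hF : ContMDiff I J ∞ F) (v w : TangentSpace I x) :
    secondFundamentalFormAt hF x v w = secondFundamentalFormAt hF x w v :=
  secondFundamentalForm_comm hF (mdifferentiableAt_extend ..) (mdifferentiableAt_extend ..)

end SecondFundamentalForm

section RightInverse

variable {P : Type*} [NormedAddCommGroup P] [NormedSpace ℝ P]
  {E : Type*} [NormedAddCommGroup E] [NormedSpace ℝ E]
  {E' : Type*} [NormedAddCommGroup E'] [NormedSpace ℝ E'] [FiniteDimensional ℝ E']
  {n : WithTop ℕ∞} {A : P → E →L[ℝ] E'} {O : Set P} {z₀ : P}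

theorem exists_contDiffOn_rightInverse (hO : IsOpen O) (hz₀ : z₀ ∈ O) (hA : ContDiffOn ℝ n A O)
    (hs : Function.Surjective (A z₀)) :
    ∃ V ⊆ O, IsOpen V ∧ z₀ ∈ V ∧ ∃ B : P → E' →L[ℝ] E, ContDiffOn ℝ n B V ∧
      ∀ z ∈ V, ∀ q, A z (B z q) = q := by
  have : CompleteSpace E' := FiniteDimensional.complete ℝ E'
  obtain ⟨R, hR⟩ := (A z₀).exists_rightInverse_of_surjective (LinearMap.range_eq_top.2 hs)
  have hAR : ContDiffOn ℝ n (fun z ↦ (A z).comp R) O := hA.clm_comp contDiffOn_const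
  let U : Set (E' →L[ℝ] E') := Set.range ((↑) : (E' ≃L[ℝ] E') → E' →L[ℝ] E')
  refine ⟨O ∩ (fun z ↦ (A z).comp R) ⁻¹' U, Set.inter_subset_left,
    hAR.continuousOn.isOpen_inter_preimage hO ContinuousLinearEquiv.isOpen,
    ⟨hz₀, ContinuousLinearEquiv.refl ℝ E', hR.symm⟩,
    fun z ↦ R.comp ((A z).comp R).inverse, ?_, ?_⟩
  · rintro z ⟨hz, e, he⟩
    have he' : (e : E' →L[ℝ] E') = (A z).comp R := he
    have hinv : ContDiffAt ℝ n ContinuousLinearMap.inverse ((A z).comp R) :=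
      he' ▸ contDiffAt_map_inverse e
    exact contDiffWithinAt_const.clm_comp (hinv.comp_contDiffWithinAt z
      (f := fun z ↦ (A z).comp R) ((hAR z hz).mono Set.inter_subset_left))
  · rintro z ⟨-, e, he⟩ q
    exact (show ((A z).comp R).IsInvertible from ⟨e, he⟩).self_apply_inverse q

theorem exists_contDiffOn_apply_eq (hO : IsOpen O) (hz₀ : z₀ ∈ O) (hA : ContDiffOn ℝ n A O)
    (hs : Function.Surjective (A z₀)) (w : E) :
    ∃ V ⊆ O, IsOpen V ∧ z₀ ∈ V ∧ ∃ u : P → E, ContDiffOn ℝ n u V ∧ u z₀ = w ∧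
      ∀ z ∈ V, A z (u z) = A z₀ w := by
  obtain ⟨V, hVO, hV, hz₀V, B, hB, hAB⟩ := exists_contDiffOn_rightInverse hO hz₀ hA hs
  refine ⟨V, hVO, hV, hz₀V, fun z ↦ w + B z (A z₀ w - A z w), ?_, by simp, fun z hz ↦ ?_⟩
  · exact contDiffOn_const.add
      (hB.clm_apply (contDiffOn_const.sub ((hA.mono hVO).clm_apply contDiffOn_const)))
  · rw [map_add, hAB z hz, add_sub_cancel]

end RightInverse

section Extension

variable {E : Type*} [NormedAddCommGroup E] [NormedSpace ℝ E]
  {H : Type*} [TopologicalSpace H] {I : ModelWithCorners ℝ E H} [I.Boundaryless]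
  {M : Type*} [TopologicalSpace M] [ChartedSpace H M]
  {E' : Type*} [NormedAddCommGroup E'] [NormedSpace ℝ E']
  {H' : Type*} [TopologicalSpace H'] {J : ModelWithCorners ℝ E' H'}
  {N : Type*} [TopologicalSpace N] [ChartedSpace H' N]
  {F : M → N} {x y : M}

theorem mfderiv_coordField [IsManifold I 1 M] [IsManifold J 1 N]
    (hy : y ∈ (chartAt H x).source) (hFy : F y ∈ (chartAt H' (F x)).source) (hF : MDiffAt F y)
    (u : E) :
    mfderiv I J F y (coordField I x u y)
      = coordField J (F x) (fderiv ℝ (writtenInExtChartAt I J x F) (extChartAt I x y) u)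
        (F y) := by
  have hFc : MDiffAt (extChartAt J (F x) ∘ F) y :=
    (mdifferentiableAt_extChartAt hFy).comp y hF
  have h := mvfderiv_coordField (by rwa [extChartAt_source]) hFc u
  rw [← coordField_pullbackCoord hFy (fun y ↦ mfderiv I J F y (coordField I x u y)),
    pullbackCoord_mfderiv hF hFy, h]
  rfl

variable [IsManifold I ∞ M] [IsManifold J ∞ N] [FiniteDimensional ℝ E']

theorem exists_contMDiffOn_mfderiv_eq_coordField (hF : ContMDiff I J ∞ F)
    (hs : Function.Surjective (mfderiv I J F x)) (w : TangentSpace I x) :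
    ∃ V : Set M, IsOpen V ∧ x ∈ V ∧ ∃ Z : Π y : M, TangentSpace I y, CMDiff[V] ∞ (T% Z) ∧
      Z x = w ∧ ∀ y ∈ V, mfderiv I J F y (Z y) = coordField J (F x) (mfderiv I J F x w) (F y) := by
  let g := writtenInExtChartAt I J x F
  let O := (extChartAt I x).target ∩ (extChartAt I x).symm ⁻¹' (F ⁻¹' (extChartAt J (F x)).source)
  have hO : IsOpen O := (continuousOn_extChartAt_symm x).isOpen_inter_preimage
    (isOpen_extChartAt_target x) ((isOpen_extChartAt_source (F x)).preimage hF.continuous)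
  have hxO : extChartAt I x x ∈ O := ⟨mem_extChartAt_target x, by simp⟩
  have hdg : ContDiffOn ℝ ∞ (fderiv ℝ g) O :=
    ((contMDiff_iff.1 hF).2 x (F x)).fderiv_of_isOpen hO (by simp)
  have hdg_x : ∀ v, mfderiv I J F x v = fderiv ℝ g (extChartAt I x x) v := fun v ↦ by
    have h := mfderiv_coordField (mem_chart_source H x) (mem_chart_source H' (F x))
      (hF.mdifferentiable (by simp) x) v
    rw [coordField_self] at h
    exact h.trans (coordField_self (F x) _)
  obtain ⟨V, hVO, hV, hxV, u, hu, hux, hVu⟩ := exists_contDiffOn_apply_eq hO hxO hdg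
    (fun q ↦ (hs q).imp fun v hv ↦ (hdg_x v).symm.trans hv) w
  have hVx : (extChartAt I x).source ∩ extChartAt I x ⁻¹' V ⊆ (chartAt H x).source :=
    fun y hy ↦ extChartAt_source I x ▸ hy.1
  refine ⟨(extChartAt I x).source ∩ extChartAt I x ⁻¹' V,
    (continuousOn_extChartAt x).isOpen_inter_preimage (isOpen_extChartAt_source x) hV,
    ⟨mem_extChartAt_source x, hxV⟩, fun y ↦ coordField I x (u (extChartAt I x y)) y, ?_, ?_, ?_⟩
  · exact contMDiffOn_coordField
      ((continuousOn_extChartAt x).isOpen_inter_preimage (isOpen_extChartAt_source x) hV) hVx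
      (hu.contMDiffOn.comp (contMDiffOn_extChartAt.mono hVx) fun y hy ↦ hy.2)
  · exact (congrArg (coordField I x · x) hux).trans (coordField_self x w)
  · intro y hy
    have hFy : F y ∈ (chartAt H' (F x)).source := by
      have hFy := (hVO hy.2).2
      rw [Set.mem_preimage, (extChartAt I x).left_inv hy.1] at hFy
      exact extChartAt_source J (F x) ▸ hFy
    rw [mfderiv_coordField (hVx hy) hFy (hF.mdifferentiable (by simp) y), hdg_x]
    exact congrArg (coordField J (F x) · (F y)) (hVu _ hy.2)

variable [FiniteDimensional ℝ E] [T2Space M]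

theorem exists_isSmoothField_mfderiv_eq_smul_coordField (hF : ContMDiff I J ∞ F)
    (hs : Function.Surjective (mfderiv I J F x)) (w : TangentSpace I x) :
    ∃ Y : Π y : M, TangentSpace I y, IsSmoothField I Y ∧ Y x = w ∧ ∃ f : M → ℝ, f =ᶠ[𝓝 x] 1 ∧
      ∀ y, mfderiv I J F y (Y y) = f y • coordField J (F x) (mfderiv I J F x w) (F y) := by
  obtain ⟨V, hV, hxV, Z, hZ, hZx, hFZ⟩ := exists_contMDiffOn_mfderiv_eq_coordField hF hs w
  obtain ⟨f, hf, -⟩ := (SmoothBumpFunction.nhds_basis_support (I := I)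
    (hV.mem_nhds hxV)).mem_iff.1 (hV.mem_nhds hxV)
  refine ⟨(f : M → ℝ) • Z,
    ContMDiffOn.smul_section_of_tsupport f.contMDiff.contMDiffOn hV hf hZ, ?_, f,
    f.eventuallyEq_one, fun y ↦ ?_⟩
  · rw [Pi.smul_apply', f.eq_one, one_smul, hZx]
  · rw [Pi.smul_apply', map_smul]
    by_cases hy : y ∈ V
    · rw [hFZ y hy]
    · rw [image_eq_zero_of_notMem_tsupport fun h ↦ hy (hf h), zero_smul, zero_smul]

theorem exists_isSmoothField_related (hF : ContMDiff I J ∞ F)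
    (hs : Function.Surjective (mfderiv I J F x)) (w : TangentSpace I x) :
    ∃ Y : Π y : M, TangentSpace I y, IsSmoothField I Y ∧ Y x = w ∧
      ∃ Q : Π q : N, TangentSpace J q, MDiffAt (T% Q) (F x) ∧
        ∀ᶠ y in 𝓝 x, mfderiv I J F y (Y y) = Q (F y) := by
  obtain ⟨Y, hY, hYx, f, hf, hFY⟩ := exists_isSmoothField_mfderiv_eq_smul_coordField hF hs w
  refine ⟨Y, hY, hYx, coordField J (F x) (mfderiv I J F x w), mdifferentiableAt_coordField _ _, ?_⟩
  filter_upwards [hf] with y hy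
  rw [hFY, hy, Pi.one_apply, one_smul]

theorem exists_isSmoothField_isVertical (hF : ContMDiff I J ∞ F)
    (hs : Function.Surjective (mfderiv I J F x)) {w : TangentSpace I x}
    (hw : w ∈ verticalSpace I J F x) :
    ∃ Y : Π y : M, TangentSpace I y, IsSmoothField I Y ∧ IsVertical I J F Y ∧ Y x = w := by
  obtain ⟨Y, hY, hYx, f, -, hFY⟩ := exists_isSmoothField_mfderiv_eq_smul_coordField hF hs w
  refine ⟨Y, hY, fun y ↦ ?_, hYx⟩
  have h0 : coordField J (F x) (mfderiv I J F x w) (F y) = 0 :=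
    (congrArg (coordField J (F x) · (F y)) hw).trans (map_zero _)
  exact (hFY y).trans (by rw [h0, smul_zero])

theorem exists_isSmoothField_eq (w : TangentSpace I x) :
    ∃ Y : Π y : M, TangentSpace I y, IsSmoothField I Y ∧ Y x = w := by
  obtain ⟨Y, hY, hYx, -⟩ := exists_isSmoothField_related (contMDiff_id (I := I) (M := M))
    (by rw [mfderiv_id]; exact Function.surjective_id) w
  exact ⟨Y, hY, hYx⟩

end Extension

section LocalMin

variable {E : Type*} [NormedAddCommGroup E] [NormedSpace ℝ E]
  {H : Type*} [TopologicalSpace H] {I : ModelWithCorners ℝ E H} [I.Boundaryless]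
  {M : Type*} [TopologicalSpace M] [ChartedSpace H M] [IsManifold I 1 M]

theorem mvfderiv_eq_zero_of_isLocalMin {f : M → ℝ} {x : M} (hf : MDiffAt f x)
    (h : IsLocalMin f x) : mvfderiv I f x = 0 := by
  ext v
  have hmin : IsLocalMin (f ∘ (extChartAt I x).symm) (extChartAt I x x) :=
    IsLocalMin.comp_continuous (by rwa [extChartAt_to_inv]) (continuousAt_extChartAt_symm x)
  have hv := mvfderiv_coordField (mem_extChartAt_source x) hf v
  rwa [hmin.fderiv_eq_zero, coordField_self] at hv

end LocalMin

section MetricCompatibility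

variable {E : Type*} [NormedAddCommGroup E] [NormedSpace ℝ E] [FiniteDimensional ℝ E]
  {H : Type*} [TopologicalSpace H] {I : ModelWithCorners ℝ E H}
  {M : Type*} [TopologicalSpace M] [ChartedSpace H M] [IsManifold I ∞ M]
  [RiemannianBundle (fun x : M ↦ TangentSpace I x)]
  [IsContMDiffRiemannianBundle I ∞ E (fun x : M ↦ TangentSpace I x)]
  {x : M} {X Y : Π x : M, TangentSpace I x}

theorem mvfderiv_inner (hX : MDiffAt (T% X) x) (hY : MDiffAt (T% Y) x) (v : TangentSpace I x) :
    mvfderiv I (fun y ↦ (inner ℝ (X y) (Y y) : ℝ)) x v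
      = inner ℝ (leviCivita I X x v) (Y x) + inner ℝ (X x) (leviCivita I Y x v) := by
  simpa only [extend_apply_self] using!
    mvfderiv_inner_leviCivita I (mdifferentiableAt_extend I E v) hX hY

theorem mvfderiv_inner_self (hY : MDiffAt (T% Y) x) (v : TangentSpace I x) :
    mvfderiv I (fun y ↦ (inner ℝ (Y y) (Y y) : ℝ)) x v
      = 2 * inner ℝ (leviCivita I Y x v) (Y x) := by
  rw [mvfderiv_inner hY hY, real_inner_comm, two_mul]

end MetricCompatibility

section Submersion

variable {E : Type*} [NormedAddCommGroup E] [NormedSpace ℝ E]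
  {H : Type*} [TopologicalSpace H] {I : ModelWithCorners ℝ E H}
  {M : Type*} [TopologicalSpace M] [ChartedSpace H M]
  [RiemannianBundle (fun x : M ↦ TangentSpace I x)]
  {E' : Type*} [NormedAddCommGroup E'] [NormedSpace ℝ E']
  {H' : Type*} [TopologicalSpace H'] {J : ModelWithCorners ℝ E' H'}
  {N : Type*} [TopologicalSpace N] [ChartedSpace H' N]
  [RiemannianBundle (fun x : N ↦ TangentSpace J x)]
  {F : M → N} {x : M} {u v w h k : TangentSpace I x}

namespace IsRiemannianSubmersion

theorem inner_mfderiv_of_mem_orthogonal (hF : IsRiemannianSubmersion I J F)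
    (hh : h ∈ (verticalSpace I J F x)ᗮ) (hk : k ∈ (verticalSpace I J F x)ᗮ) :
    (inner ℝ (mfderiv I J F x h) (mfderiv I J F x k) : ℝ) = inner ℝ h k := by
  rw [real_inner_eq_norm_add_mul_self_sub_norm_mul_self_sub_norm_mul_self_div_two,
    real_inner_eq_norm_add_mul_self_sub_norm_mul_self_sub_norm_mul_self_div_two, ← map_add,
    hF.norm_mfderiv x h hh, hF.norm_mfderiv x k hk,
    hF.norm_mfderiv x (h + k) (Submodule.add_mem _ hh hk)]

variable [FiniteDimensional ℝ E]

theorem inner_mfderiv (hF : IsRiemannianSubmersion I J F) (v : TangentSpace I x)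
    (hh : h ∈ (verticalSpace I J F x)ᗮ) :
    (inner ℝ (mfderiv I J F x v) (mfderiv I J F x h) : ℝ) = inner ℝ v h := by
  obtain ⟨u, hu, k, hk, rfl⟩ := (verticalSpace I J F x).exists_add_mem_mem_orthogonal v
  have hFu : mfderiv I J F x u = 0 := hu
  rw [map_add, hFu, zero_add, hF.inner_mfderiv_of_mem_orthogonal hk hh, inner_add_left,
    Submodule.inner_right_of_mem_orthogonal hu hh, zero_add]

theorem inner_mfderiv_self_le (hF : IsRiemannianSubmersion I J F) (v : TangentSpace I x) :
    (inner ℝ (mfderiv I J F x v) (mfderiv I J F x v) : ℝ) ≤ inner ℝ v v := by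
  obtain ⟨u, hu, k, hk, rfl⟩ := (verticalSpace I J F x).exists_add_mem_mem_orthogonal v
  have hFu : mfderiv I J F x u = 0 := hu
  rw [map_add, hFu, zero_add, hF.inner_mfderiv_of_mem_orthogonal hk hk, inner_add_left,
    inner_add_right, inner_add_right, Submodule.inner_right_of_mem_orthogonal hu hk,
    Submodule.inner_left_of_mem_orthogonal hu hk, add_zero, zero_add]
  exact le_add_of_nonneg_left real_inner_self_nonneg

theorem exists_mem_orthogonal_mfderiv_eq (hF : IsRiemannianSubmersion I J F) (x : M)
    (q : TangentSpace J (F x)) : ∃ h ∈ (verticalSpace I J F x)ᗮ, mfderiv I J F x h = q := by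
  obtain ⟨v, rfl⟩ := hF.surjective_mfderiv x q
  obtain ⟨u, hu, k, hk, rfl⟩ := (verticalSpace I J F x).exists_add_mem_mem_orthogonal v
  have hFu : mfderiv I J F x u = 0 := hu
  exact ⟨k, hk, by rw [map_add, hFu, zero_add]⟩

variable [FiniteDimensional ℝ E'] [I.Boundaryless] [IsManifold I ∞ M] [IsManifold J ∞ N]
  [IsContMDiffRiemannianBundle I ∞ E (fun x : M ↦ TangentSpace I x)]
  [IsContMDiffRiemannianBundle J ∞ E' (fun x : N ↦ TangentSpace J x)]

-- The function `|Y|² - |Q|² ∘ F` is nonnegative near `x`, as `F_*` does not increase lengths, and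
-- vanishes at `x`, where `Y` is horizontal; so its differential at `x` is zero.
theorem mvfderiv_inner_self_of_related (hF : IsRiemannianSubmersion I J F)
    {Y : Π y : M, TangentSpace I y} (hY : MDiffAt (T% Y) x) (hYx : Y x ∈ (verticalSpace I J F x)ᗮ)
    {Q : Π q : N, TangentSpace J q} (hQ : MDiffAt (T% Q) (F x))
    (hYQ : ∀ᶠ y in 𝓝 x, mfderiv I J F y (Y y) = Q (F y)) (v : TangentSpace I x) :
    mvfderiv I (fun y ↦ (inner ℝ (Y y) (Y y) : ℝ)) x v
      = mvfderiv J (fun q ↦ (inner ℝ (Q q) (Q q) : ℝ)) (F x) (mfderiv I J F x v) := by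
  let f : M → ℝ := fun y ↦ inner ℝ (Y y) (Y y)
  let g : N → ℝ := fun q ↦ inner ℝ (Q q) (Q q)
  have hFx : MDiffAt F x := hF.contMDiff.mdifferentiable (by simp) x
  have hf : MDiffAt f x := mdifferentiableAt_inner I hY hY
  have hg : MDiffAt g (F x) := mdifferentiableAt_inner J hQ hQ
  have hmin : IsLocalMin (f - g ∘ F) x := by
    filter_upwards [hYQ] with y hy
    have hx : (f - g ∘ F) x = 0 := by
      simp only [Pi.sub_apply, Function.comp_apply, f, g, ← hYQ.self_of_nhds,
        hF.inner_mfderiv _ hYx, sub_self]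
    rw [hx, Pi.sub_apply, sub_nonneg, Function.comp_apply]
    exact (congrArg (fun q ↦ (inner ℝ q q : ℝ)) hy).symm.trans_le (hF.inner_mfderiv_self_le (Y y))
  have hzero := mvfderiv_eq_zero_of_isLocalMin (hf.sub (hg.comp x hFx)) hmin
  rw [mvfderiv_sub hf (hg.comp x hFx), sub_eq_zero] at hzero
  exact (DFunLike.congr_fun hzero v).trans (mfderiv_comp_apply x hg hFx v)

variable [T2Space M]

theorem inner_secondFundamentalFormAt_self (hF : IsRiemannianSubmersion I J F)
    (v : TangentSpace I x) (hh : h ∈ (verticalSpace I J F x)ᗮ) :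
    (inner ℝ (secondFundamentalFormAt hF.contMDiff x v h) (mfderiv I J F x h) : ℝ) = 0 := by
  obtain ⟨Y, hY, rfl, Q, hQ, hYQ⟩ :=
    exists_isSmoothField_related hF.contMDiff (hF.surjective_mfderiv x) h
  have hYx := hY.mdifferentiableAt x
  have hdiff := hF.mvfderiv_inner_self_of_related hYx hh hQ hYQ v
  rw [mvfderiv_inner_self hYx, mvfderiv_inner_self hQ, ← hYQ.self_of_nhds] at hdiff
  rw [secondFundamentalFormAt_of_related hF.contMDiff hYx hQ hYQ, inner_sub_left,
    hF.inner_mfderiv _ hh]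
  linarith

theorem inner_secondFundamentalFormAt_antisymm (hF : IsRiemannianSubmersion I J F)
    (v : TangentSpace I x) (hh : h ∈ (verticalSpace I J F x)ᗮ)
    (hk : k ∈ (verticalSpace I J F x)ᗮ) :
    (inner ℝ (secondFundamentalFormAt hF.contMDiff x v h) (mfderiv I J F x k) : ℝ)
      = -inner ℝ (secondFundamentalFormAt hF.contMDiff x v k) (mfderiv I J F x h) := by
  have hhk := hF.inner_secondFundamentalFormAt_self v (Submodule.add_mem _ hh hk)
  simp only [map_add, inner_add_left, inner_add_right, hF.inner_secondFundamentalFormAt_self v hh,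
    hF.inner_secondFundamentalFormAt_self v hk] at hhk
  linarith

variable [J.Boundaryless]

-- The trilinear form `⟪(∇F_*)(h, k), F_* l⟫` on horizontal vectors is symmetric in its first two
-- arguments and antisymmetric in its last two.
theorem secondFundamentalFormAt_of_mem_orthogonal (hF : IsRiemannianSubmersion I J F)
    (hh : h ∈ (verticalSpace I J F x)ᗮ) (hk : k ∈ (verticalSpace I J F x)ᗮ) :
    secondFundamentalFormAt hF.contMDiff x h k = 0 := by
  refine ext_inner_right ℝ fun q ↦ ?_
  obtain ⟨l, hl, rfl⟩ := hF.exists_mem_orthogonal_mfderiv_eq x q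
  have hhkl := hF.inner_secondFundamentalFormAt_antisymm h hk hl
  have hlhk := hF.inner_secondFundamentalFormAt_antisymm l hh hk
  have hklh := hF.inner_secondFundamentalFormAt_antisymm k hl hh
  rw [secondFundamentalFormAt_comm hF.contMDiff h l] at hhkl
  rw [secondFundamentalFormAt_comm hF.contMDiff l k] at hlhk
  rw [secondFundamentalFormAt_comm hF.contMDiff k h] at hklh
  rw [inner_zero_left]
  linarith

end IsRiemannianSubmersion

end Submersion

section FundamentalTensors

variable {E : Type*} [NormedAddCommGroup E] [NormedSpace ℝ E] [FiniteDimensional ℝ E]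
  {H : Type*} [TopologicalSpace H] {I : ModelWithCorners ℝ E H}
  {M : Type*} [TopologicalSpace M] [ChartedSpace H M]
  [RiemannianBundle (fun x : M ↦ TangentSpace I x)]
  {E' : Type*} [NormedAddCommGroup E'] [NormedSpace ℝ E']
  {H' : Type*} [TopologicalSpace H'] {J : ModelWithCorners ℝ E' H'}
  {N : Type*} [TopologicalSpace N] [ChartedSpace H' N]
  {F : M → N} {x : M} {X Y U Z : Π x : M, TangentSpace I x}

theorem vertPart_of_isVertical (hX : IsVertical I J F X) : vertPart I J F X = X :=
  funext fun x ↦ Submodule.starProjection_eq_self_iff.2 (hX x)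

theorem vertPart_of_isHorizontal (hX : IsHorizontal I J F X) : vertPart I J F X = 0 :=
  funext fun x ↦ (Submodule.starProjection_apply_eq_zero_iff _).2 (hX x)

theorem horPart_of_isHorizontal (hX : IsHorizontal I J F X) : horPart I J F X = X :=
  funext fun x ↦ Submodule.starProjection_eq_self_iff.2 (hX x)

variable [IsManifold I ∞ M] [IsContMDiffRiemannianBundle I ∞ E (fun x : M ↦ TangentSpace I x)]

theorem nabla_zero (X : Π x : M, TangentSpace I x) : nabla I X 0 = 0 :=
  funext fun x ↦ DFunLike.congr_fun (congrFun (leviCivita I).zero x) (X x)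

theorem horPart_nabla_zero (X : Π x : M, TangentSpace I x) (x : M) :
    horPart I J F (nabla I X 0) x = 0 := by
  rw [nabla_zero, horPart, Pi.zero_apply, map_zero]

theorem tensorT_of_isVertical_of_isHorizontal (hX : IsVertical I J F X)
    (hY : IsHorizontal I J F Y) (x : M) :
    tensorT I J F X Y x = (verticalSpace I J F x).starProjection (leviCivita I Y x (X x)) := by
  rw [tensorT, vertPart_of_isVertical hX, vertPart_of_isHorizontal hY, horPart_of_isHorizontal hY,
    horPart_nabla_zero, zero_add]
  rfl

theorem tensorA_of_isHorizontal (hX : IsHorizontal I J F X) (hY : IsHorizontal I J F Y) (x : M) :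
    tensorA I J F X Y x = (verticalSpace I J F x).starProjection (leviCivita I Y x (X x)) := by
  rw [tensorA, horPart_of_isHorizontal hX, vertPart_of_isHorizontal hY, horPart_of_isHorizontal hY,
    horPart_nabla_zero, add_zero]
  rfl

theorem inner_leviCivita_of_isVertical_of_isHorizontal (hU : MDiffAt (T% U) x)
    (hUv : IsVertical I J F U) (hZ : MDiffAt (T% Z) x) (hZh : IsHorizontal I J F Z)
    (v : TangentSpace I x) :
    (inner ℝ (leviCivita I U x v) (Z x) : ℝ) = -inner ℝ (U x) (leviCivita I Z x v) := by
  have hUZ : (fun y ↦ (inner ℝ (U y) (Z y) : ℝ)) = fun _ ↦ 0 :=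
    funext fun y ↦ Submodule.inner_right_of_mem_orthogonal (hUv y) (hZh y)
  have hinner := mvfderiv_inner hU hZ v
  rw [hUZ, mvfderiv_const] at hinner
  exact eq_neg_of_add_eq_zero_left hinner.symm

variable [I.Boundaryless] [T2Space M] [FiniteDimensional ℝ E'] [IsManifold J ∞ N]
  [RiemannianBundle (fun x : N ↦ TangentSpace J x)]
  [IsContMDiffRiemannianBundle J ∞ E' (fun x : N ↦ TangentSpace J x)]

theorem isTotallyGeodesicMap_iff (hF : ContMDiff I J ∞ F) :
    IsTotallyGeodesicMap I J F ↔
      ∀ x (v w : TangentSpace I x), secondFundamentalFormAt hF x v w = 0 := by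
  refine ⟨fun h x v w ↦ ?_, fun h X Y _ hY x ↦ ?_⟩
  · obtain ⟨X, hX, rfl⟩ := exists_isSmoothField_eq v
    obtain ⟨Y, hY, rfl⟩ := exists_isSmoothField_eq w
    exact (secondFundamentalFormAt_apply hF (hY.mdifferentiableAt x) _).trans (h X Y hX hY x)
  · exact (secondFundamentalFormAt_apply hF (hY.mdifferentiableAt x) _).symm.trans (h x _ _)

namespace IsRiemannianSubmersion

theorem inner_secondFundamentalFormAt_of_mem (hF : IsRiemannianSubmersion I J F)
    (w : TangentSpace I x) {u : TangentSpace I x} (hu : u ∈ verticalSpace I J F x)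
    (hZ : MDiffAt (T% Z) x) (hZh : IsHorizontal I J F Z) :
    (inner ℝ (secondFundamentalFormAt hF.contMDiff x w u) (mfderiv I J F x (Z x)) : ℝ)
      = inner ℝ u (leviCivita I Z x w) := by
  obtain ⟨U, hU, hUv, rfl⟩ :=
    exists_isSmoothField_isVertical hF.contMDiff (hF.surjective_mfderiv x) hu
  have hUx := hU.mdifferentiableAt x
  have hform : secondFundamentalFormAt hF.contMDiff x w (U x)
      = -mfderiv I J F x (leviCivita I U x w) := by
    rw [secondFundamentalFormAt_of_related hF.contMDiff hUx (Q := 0)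
      (mdifferentiableAt_zeroSection ..) (.of_forall hUv), (leviCivita J).zero]
    exact zero_sub _
  rw [hform, inner_neg_left, hF.inner_mfderiv _ (hZh x),
    inner_leviCivita_of_isVertical_of_isHorizontal hUx hUv hZ hZh, neg_neg]

theorem starProjection_leviCivita_eq_zero_iff (hF : IsRiemannianSubmersion I J F)
    (w : TangentSpace I x) (hZ : MDiffAt (T% Z) x) (hZh : IsHorizontal I J F Z) :
    (verticalSpace I J F x).starProjection (leviCivita I Z x w) = 0 ↔
      ∀ u ∈ verticalSpace I J F x,
        (inner ℝ (secondFundamentalFormAt hF.contMDiff x w u) (mfderiv I J F x (Z x)) : ℝ) = 0 := by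
  rw [Submodule.starProjection_apply_eq_zero_iff, Submodule.mem_orthogonal]
  refine forall₂_congr fun u hu ↦ ?_
  rw [hF.inner_secondFundamentalFormAt_of_mem w hu hZ hZh]

end IsRiemannianSubmersion

end FundamentalTensors

section KillingField

variable {E : Type*} [NormedAddCommGroup E] [NormedSpace ℝ E] [FiniteDimensional ℝ E]
  {H : Type*} [TopologicalSpace H] {I : ModelWithCorners ℝ E H}
  {M : Type*} [TopologicalSpace M] [ChartedSpace H M] [IsManifold I ∞ M]
  {X Y Z ξ : Π x : M, TangentSpace I x}

theorem IsSmoothField.mlieBracket (hX : IsSmoothField I X) (hY : IsSmoothField I Y) :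
    IsSmoothField I (mlieBracket I X Y) :=
  have : IsManifold I (minSmoothness ℝ 2) M := by
    rw [minSmoothness_of_isRCLikeNormedField]; infer_instance
  have : IsManifold I (((⊤ : ℕ∞) : WithTop ℕ∞) + 1) M := inferInstanceAs (IsManifold I ∞ M)
  ContDiff.mlieBracket_vectorField (m := ⊤) (n := ⊤) hX hY (by simp)

theorem IsSmoothField.mlieBracket_mlieBracket (hX : IsSmoothField I X) (hY : IsSmoothField I Y)
    (hZ : IsSmoothField I Z) (x : M) :
    VectorField.mlieBracket I X (VectorField.mlieBracket I Y Z) x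
      = VectorField.mlieBracket I (VectorField.mlieBracket I X Y) Z x
        + VectorField.mlieBracket I Y (VectorField.mlieBracket I X Z) x := by
  have : IsManifold I (minSmoothness ℝ 3) M := by
    rw [minSmoothness_of_isRCLikeNormedField]; infer_instance
  have hle : minSmoothness ℝ 2 ≤ ∞ := by
    rw [minSmoothness_of_isRCLikeNormedField]; exact ENat.LEInfty.out
  exact leibniz_identity_mlieBracket_apply ((hX.contMDiffAt).of_le hle) ((hY.contMDiffAt).of_le hle)
    ((hZ.contMDiffAt).of_le hle)

variable [RiemannianBundle (fun x : M ↦ TangentSpace I x)]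
  [IsContMDiffRiemannianBundle I ∞ E (fun x : M ↦ TangentSpace I x)]

variable (I) in
/-- A Killing vector field: a smooth vector field along which the Lie derivative of the metric
vanishes, expressed as the skew-symmetry of `∇ξ`. -/
structure IsKillingField (ξ : Π x : M, TangentSpace I x) : Prop where
  isSmoothField : IsSmoothField I ξ
  inner_leviCivita : ∀ x (v w : TangentSpace I x),
    (inner ℝ (leviCivita I ξ x v) w : ℝ) = -inner ℝ v (leviCivita I ξ x w)

theorem inner_leviCivita_add_inner_leviCivita {x : M} (hZ : MDiffAt (T% Z) x)
    (hX : MDiffAt (T% X) x) (hY : MDiffAt (T% Y) x) :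
    (inner ℝ (leviCivita I Z x (X x)) (Y x) + inner ℝ (X x) (leviCivita I Z x (Y x)) : ℝ)
      = mvfderiv I (fun y ↦ (inner ℝ (X y) (Y y) : ℝ)) x (Z x)
        - inner ℝ (mlieBracket I Z X x) (Y x) - inner ℝ (X x) (mlieBracket I Z Y x) := by
  rw [mvfderiv_inner hX hY, ← leviCivita_sub_leviCivita hZ hX, ← leviCivita_sub_leviCivita hZ hY,
    inner_sub_left, inner_sub_right]
  ring

end KillingField

section Sasakian

variable {E : Type*} [NormedAddCommGroup E] [NormedSpace ℝ E]
  {H : Type*} [TopologicalSpace H] {I : ModelWithCorners ℝ E H}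
  {M : Type*} [TopologicalSpace M] [ChartedSpace H M] [IsManifold I ∞ M]
  [RiemannianBundle (fun x : M ↦ TangentSpace I x)]
  {S : AlmostContactMetricStructure I M} {X Y : Π x : M, TangentSpace I x}

namespace AlmostContactMetricStructure

theorem isSmoothField_phi (S : AlmostContactMetricStructure I M) (hX : IsSmoothField I X) :
    IsSmoothField I (S.phi X) :=
  ContMDiff.clm_bundle_apply (F₁ := E) (F₂ := E) (E₁ := fun x : M ↦ TangentSpace I x)
    (E₂ := fun x : M ↦ TangentSpace I x) (b := fun x : M ↦ x) (ϕ := S.φ) S.smooth_φ hX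

theorem two_mul_dη (S : AlmostContactMetricStructure I M) (X Y : Π x : M, TangentSpace I x)
    (x : M) :
    2 * S.dη X Y x = mvfderiv I (fun y ↦ S.η y (Y y)) x (X x)
      - mvfderiv I (fun y ↦ S.η y (X y)) x (Y x) - S.η x (mlieBracket I X Y x) := by
  rw [dη, ← mul_assoc, mul_one_div_cancel two_ne_zero, one_mul]

theorem eq_zero_of_φ_eq_zero_of_η_eq_zero {x : M} {v : TangentSpace I x} (hφ : S.φ x v = 0)
    (hη : S.η x v = 0) : v = 0 := by
  have hφφ := S.φ_φ x v
  rwa [hφ, hη, map_zero, zero_smul, add_zero, eq_comm, neg_eq_zero] at hφφ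

namespace IsSasakian

theorem mvfderiv_η_ξ (hS : S.IsSasakian) (hX : IsSmoothField I X) (x : M) :
    mvfderiv I (fun y ↦ S.η y (X y)) x (S.ξ x) = S.η x (mlieBracket I S.ξ X x) := by
  have hdη := S.two_mul_dη S.ξ X x
  have hηξ : mvfderiv I (fun y ↦ S.η y (S.ξ y)) x = 0 := by
    simp only [S.η_ξ]
    exact mvfderiv_const _
  rw [hS.contact _ _ S.smooth_ξ hX, real_inner_comm, ← S.η_eq_inner, S.η_φ, hηξ, mul_zero,
    zero_apply, sub_zero] at hdη
  exact sub_eq_zero.1 hdη.symm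

theorem mlieBracket_ξ_phi (hS : S.IsSasakian) (hY : IsSmoothField I Y) (x : M) :
    mlieBracket I S.ξ (S.phi Y) x = S.φ x (mlieBracket I S.ξ Y x) := by
  have hφξ : S.phi S.ξ = 0 := funext S.φ_ξ
  have hηφ : (fun y ↦ S.η y (S.phi Y y)) = fun _ ↦ 0 := funext fun y ↦ S.η_φ y _
  have hη := hS.mvfderiv_η_ξ (S.isSmoothField_phi hY) x
  rw [hηφ, mvfderiv_const] at hη
  have hN := hS.normal S.ξ Y S.smooth_ξ hY x
  rw [hS.contact _ _ S.smooth_ξ hY, real_inner_comm, ← S.η_eq_inner, S.η_φ, mul_zero, zero_smul,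
    add_zero, nijenhuis, hφξ, mlieBracket_zero_left, mlieBracket_zero_left, Pi.zero_apply, map_zero,
    add_zero, sub_zero, ← map_sub] at hN
  refine (sub_eq_zero.1 (eq_zero_of_φ_eq_zero_of_η_eq_zero hN ?_)).symm
  rw [map_sub, S.η_φ, zero_sub, ← hη]
  exact neg_zero

end IsSasakian

variable [IsContMDiffRiemannianBundle I ∞ E (fun x : M ↦ TangentSpace I x)]

theorem contMDiff_η (S : AlmostContactMetricStructure I M) (hX : IsSmoothField I X) :
    CMDiff ∞ (fun y ↦ S.η y (X y)) := by
  simp only [S.η_eq_inner]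
  exact ContMDiff.inner_bundle (F := E) (E := fun x : M ↦ TangentSpace I x) (b := fun x : M ↦ x)
    hX S.smooth_ξ

variable [FiniteDimensional ℝ E]

theorem IsSasakian.inner_leviCivita_ξ_ξ (hS : S.IsSasakian) (hX : IsSmoothField I X) (x : M) :
    (inner ℝ (leviCivita I S.ξ x (X x)) (S.ξ x) : ℝ)
      = -inner ℝ (X x) (leviCivita I S.ξ x (S.ξ x)) := by
  have hK := inner_leviCivita_add_inner_leviCivita (S.smooth_ξ.mdifferentiableAt x)
    (hX.mdifferentiableAt x) (S.smooth_ξ.mdifferentiableAt x)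
  have hη := hS.mvfderiv_η_ξ hX x
  simp only [S.η_eq_inner] at hη
  rw [hη, mlieBracket_self, Pi.zero_apply, inner_zero_right] at hK
  linarith

variable [I.Boundaryless]

theorem mvfderiv_dη (S : AlmostContactMetricStructure I M) (hX : IsSmoothField I X)
    (hY : IsSmoothField I Y) (x : M) (v : TangentSpace I x) :
    2 * mvfderiv I (S.dη X Y) x v
      = mvfderiv I (fun y ↦ mvfderiv I (fun y ↦ S.η y (Y y)) y (X y)) x v
        - mvfderiv I (fun y ↦ mvfderiv I (fun y ↦ S.η y (X y)) y (Y y)) x v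
        - mvfderiv I (fun y ↦ S.η y (mlieBracket I X Y y)) x v := by
  have hXη := mdifferentiableAt_mvfderiv ((S.contMDiff_η hY).contMDiffAt.of_le ENat.LEInfty.out)
    (hX.mdifferentiableAt x)
  have hYη := mdifferentiableAt_mvfderiv ((S.contMDiff_η hX).contMDiffAt.of_le ENat.LEInfty.out)
    (hY.mdifferentiableAt x)
  have hη := (S.contMDiff_η (hX.mlieBracket hY)).mdifferentiable (by simp) x
  have hdη := mvfderiv_smul (mdifferentiableAt_const (c := (1 / 2 : ℝ))) ((hXη.sub hYη).sub hη)
  rw [mvfderiv_sub (hXη.sub hYη) hη, mvfderiv_sub hXη hYη, mvfderiv_const] at hdη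
  refine (congrArg (2 * ·) (DFunLike.congr_fun hdη v)).trans ?_
  simp

namespace IsSasakian

theorem mvfderiv_dη_ξ (hS : S.IsSasakian) (hX : IsSmoothField I X) (hY : IsSmoothField I Y)
    (x : M) :
    mvfderiv I (S.dη X Y) x (S.ξ x)
      = S.dη (mlieBracket I S.ξ X) Y x + S.dη X (mlieBracket I S.ξ Y) x := by
  have hξx := S.smooth_ξ.mdifferentiableAt x
  have hXη := mvfderiv_mlieBracket ((S.contMDiff_η hY).contMDiffAt.of_le ENat.LEInfty.out) hξx
    (hX.mdifferentiableAt x)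
  have hYη := mvfderiv_mlieBracket ((S.contMDiff_η hX).contMDiffAt.of_le ENat.LEInfty.out) hξx
    (hY.mdifferentiableAt x)
  have hbracket := hS.mvfderiv_η_ξ (hX.mlieBracket hY) x
  rw [funext (hS.mvfderiv_η_ξ hY)] at hXη
  rw [funext (hS.mvfderiv_η_ξ hX)] at hYη
  rw [S.smooth_ξ.mlieBracket_mlieBracket hX hY, map_add] at hbracket
  have hdη := S.mvfderiv_dη hX hY x (S.ξ x)
  have hdη_left := S.two_mul_dη (mlieBracket I S.ξ X) Y x
  have hdη_right := S.two_mul_dη X (mlieBracket I S.ξ Y) x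
  linarith

theorem inner_leviCivita_ξ_phi (hS : S.IsSasakian) (hX : IsSmoothField I X)
    (hY : IsSmoothField I Y) (x : M) :
    (inner ℝ (leviCivita I S.ξ x (X x)) (S.φ x (Y x)) : ℝ)
      = -inner ℝ (X x) (leviCivita I S.ξ x (S.φ x (Y x))) := by
  have hK := inner_leviCivita_add_inner_leviCivita (S.smooth_ξ.mdifferentiableAt x)
    (hX.mdifferentiableAt x) ((S.isSmoothField_phi hY).mdifferentiableAt x)
  have hdη := hS.mvfderiv_dη_ξ hX hY x
  rw [funext (hS.contact X Y hX hY), hS.contact _ _ (S.smooth_ξ.mlieBracket hX) hY,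
    hS.contact _ _ hX (S.smooth_ξ.mlieBracket hY), ← hS.mlieBracket_ξ_phi hY] at hdη
  simp only [phi] at hK hdη
  linarith

theorem isKillingField_ξ [T2Space M] (hS : S.IsSasakian) : IsKillingField I S.ξ where
  isSmoothField := S.smooth_ξ
  inner_leviCivita x v w := by
    obtain ⟨X, hX, rfl⟩ := exists_isSmoothField_eq v
    obtain ⟨Y, hY, hYx⟩ := exists_isSmoothField_eq (-S.φ x w)
    have hw : w = S.φ x (Y x) + S.η x w • S.ξ x := by
      rw [hYx, map_neg, S.φ_φ]
      abel
    have hφ := hS.inner_leviCivita_ξ_phi hX hY x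
    have hξ := hS.inner_leviCivita_ξ_ξ hX x
    rw [hw, map_add, map_smul]
    simp only [inner_add_right, real_inner_smul_right, hφ, hξ]
    ring

end IsSasakian

end AlmostContactMetricStructure

end Sasakian

section HorizontalDecomposition

variable {E : Type*} [NormedAddCommGroup E] [NormedSpace ℝ E]
  {H : Type*} [TopologicalSpace H] {I : ModelWithCorners ℝ E H}
  {M : Type*} [TopologicalSpace M] [ChartedSpace H M]
  [RiemannianBundle (fun x : M ↦ TangentSpace I x)]
  {E' : Type*} [NormedAddCommGroup E'] [NormedSpace ℝ E']
  {H' : Type*} [TopologicalSpace H'] {J : ModelWithCorners ℝ E' H'}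
  {N : Type*} [TopologicalSpace N] [ChartedSpace H' N]
  {F : M → N} {φ : Π x : M, TangentSpace I x →ₗ[ℝ] TangentSpace I x} {ξ : Π x : M, TangentSpace I x}
  {x : M} {h u v : TangentSpace I x}

theorem exists_eq_add_smul_of_mem_orthogonal
    (hdecomp : (verticalSpace I J F x)ᗮ
      = (verticalSpace I J F x).map (φ x) ⊔ Submodule.span ℝ {ξ x})
    (hh : h ∈ (verticalSpace I J F x)ᗮ) :
    ∃ v ∈ verticalSpace I J F x, ∃ c : ℝ, φ x v + c • ξ x = h := by
  rw [hdecomp, Submodule.mem_sup] at hh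
  obtain ⟨_, ⟨v, hv, rfl⟩, _, hξ, rfl⟩ := hh
  obtain ⟨c, rfl⟩ := Submodule.mem_span_singleton.1 hξ
  exact ⟨v, hv, c, rfl⟩

variable [FiniteDimensional ℝ E] [FiniteDimensional ℝ E'] [I.Boundaryless]
  [IsManifold I ∞ M] [IsManifold J ∞ N]

theorem exists_isSmoothField_isHorizontal [T2Space M] (hF : ContMDiff I J ∞ F)
    (hs : Function.Surjective (mfderiv I J F x))
    (hφ : ∀ V, IsSmoothField I V → IsSmoothField I fun y ↦ φ y (V y)) (hξ : IsSmoothField I ξ)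
    (hdecomp : ∀ y, (verticalSpace I J F y)ᗮ
      = (verticalSpace I J F y).map (φ y) ⊔ Submodule.span ℝ {ξ y})
    (hh : h ∈ (verticalSpace I J F x)ᗮ) :
    ∃ X, IsSmoothField I X ∧ IsHorizontal I J F X ∧ X x = h := by
  obtain ⟨v, hv, c, rfl⟩ := exists_eq_add_smul_of_mem_orthogonal (hdecomp x) hh
  obtain ⟨V, hV, hVv, rfl⟩ := exists_isSmoothField_isVertical hF hs hv
  refine ⟨(fun y ↦ φ y (V y)) + c • ξ,
    ContMDiff.add_section (hφ V hV) (ContMDiff.const_smul_section hξ), fun y ↦ ?_, rfl⟩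
  rw [hdecomp]
  exact Submodule.add_mem_sup (Submodule.mem_map_of_mem (hVv y))
    (Submodule.smul_mem _ c (Submodule.mem_span_singleton_self _))

variable [RiemannianBundle (fun x : N ↦ TangentSpace J x)]
  [IsContMDiffRiemannianBundle I ∞ E (fun x : M ↦ TangentSpace I x)]
  [IsContMDiffRiemannianBundle J ∞ E' (fun x : N ↦ TangentSpace J x)]

namespace IsRiemannianSubmersion

theorem secondFundamentalFormAt_eq_zero_of_inner_eq_zero (hF : IsRiemannianSubmersion I J F)
    (hdecomp : (verticalSpace I J F x)ᗮ
      = (verticalSpace I J F x).map (φ x) ⊔ Submodule.span ℝ {ξ x}) {w : TangentSpace I x}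
    (hφ : ∀ v ∈ verticalSpace I J F x,
      (inner ℝ (secondFundamentalFormAt hF.contMDiff x w u) (mfderiv I J F x (φ x v)) : ℝ) = 0)
    (hξ : (inner ℝ (secondFundamentalFormAt hF.contMDiff x w u) (mfderiv I J F x (ξ x)) : ℝ) = 0) :
    secondFundamentalFormAt hF.contMDiff x w u = 0 := by
  refine ext_inner_right ℝ fun q ↦ ?_
  obtain ⟨k, hk, rfl⟩ := hF.exists_mem_orthogonal_mfderiv_eq x q
  obtain ⟨v, hv, c, rfl⟩ := exists_eq_add_smul_of_mem_orthogonal hdecomp hk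
  rw [map_add, map_smul, inner_add_right, inner_smul_right, hφ v hv, hξ, mul_zero, add_zero,
    inner_zero_left]

variable [T2Space M]

theorem forall_tensorT_eq_zero_iff (hF : IsRiemannianSubmersion I J F)
    (hφ : ∀ V, IsSmoothField I V → IsSmoothField I fun x ↦ φ x (V x))
    (hφV : ∀ x, (verticalSpace I J F x).map (φ x) ≤ (verticalSpace I J F x)ᗮ) :
    (∀ V W : Π x : M, TangentSpace I x, IsSmoothField I V → IsVertical I J F V →
        IsSmoothField I W → IsVertical I J F W →
        ∀ x, tensorT I J F W (fun x ↦ φ x (V x)) x = 0) ↔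
      ∀ x, ∀ w ∈ verticalSpace I J F x, ∀ u ∈ verticalSpace I J F x, ∀ v ∈ verticalSpace I J F x,
        (inner ℝ (secondFundamentalFormAt hF.contMDiff x w u) (mfderiv I J F x (φ x v)) : ℝ)
          = 0 := by
  have tensorT_eq_zero_iff {V W : Π x : M, TangentSpace I x} (hV : IsSmoothField I V)
      (hVv : IsVertical I J F V) (hWv : IsVertical I J F W) (x : M) :=
    have hφVh : IsHorizontal I J F fun x ↦ φ x (V x) :=
      fun y ↦ hφV y (Submodule.mem_map_of_mem (hVv y))
    tensorT_of_isVertical_of_isHorizontal hWv hφVh x ▸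
      hF.starProjection_leviCivita_eq_zero_iff (W x) ((hφ V hV).mdifferentiableAt x) hφVh
  refine ⟨fun hT x w hw u hu v hv ↦ ?_, fun hb V W hV hVv _ hWv x ↦
    (tensorT_eq_zero_iff hV hVv hWv x).2 fun u hu ↦ hb x _ (hWv x) u hu _ (hVv x)⟩
  obtain ⟨V, hV, hVv, rfl⟩ :=
    exists_isSmoothField_isVertical hF.contMDiff (hF.surjective_mfderiv x) hv
  obtain ⟨W, hW, hWv, rfl⟩ :=
    exists_isSmoothField_isVertical hF.contMDiff (hF.surjective_mfderiv x) hw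
  exact (tensorT_eq_zero_iff hV hVv hWv x).1 (hT V W hV hVv hW hWv x) u hu

theorem forall_tensorA_eq_zero_iff (hF : IsRiemannianSubmersion I J F)
    (hφ : ∀ V, IsSmoothField I V → IsSmoothField I fun x ↦ φ x (V x)) (hξ : IsSmoothField I ξ)
    (hdecomp : ∀ x, (verticalSpace I J F x)ᗮ
      = (verticalSpace I J F x).map (φ x) ⊔ Submodule.span ℝ {ξ x}) :
    (∀ X W : Π x : M, TangentSpace I x, IsSmoothField I X → IsHorizontal I J F X →
        IsSmoothField I W → IsVertical I J F W →
        ∀ x, tensorA I J F X (fun x ↦ φ x (W x)) x = 0) ↔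
      ∀ x, ∀ h ∈ (verticalSpace I J F x)ᗮ, ∀ u ∈ verticalSpace I J F x,
        ∀ v ∈ verticalSpace I J F x,
        (inner ℝ (secondFundamentalFormAt hF.contMDiff x h u) (mfderiv I J F x (φ x v)) : ℝ)
          = 0 := by
  have tensorA_eq_zero_iff {X W : Π x : M, TangentSpace I x} (hXh : IsHorizontal I J F X)
      (hW : IsSmoothField I W) (hWv : IsVertical I J F W) (x : M) :=
    have hφWh : IsHorizontal I J F fun x ↦ φ x (W x) := fun y ↦
      hdecomp y ▸ Submodule.mem_sup_left (Submodule.mem_map_of_mem (hWv y))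
    tensorA_of_isHorizontal hXh hφWh x ▸
      hF.starProjection_leviCivita_eq_zero_iff (X x) ((hφ W hW).mdifferentiableAt x) hφWh
  refine ⟨fun hA x h hh u hu v hv ↦ ?_, fun hb X W _ hXh hW hWv x ↦
    (tensorA_eq_zero_iff hXh hW hWv x).2 fun u hu ↦ hb x _ (hXh x) u hu _ (hWv x)⟩
  obtain ⟨X, hX, hXh, rfl⟩ := exists_isSmoothField_isHorizontal hF.contMDiff
    (hF.surjective_mfderiv x) hφ hξ hdecomp hh
  obtain ⟨W, hW, hWv, rfl⟩ :=
    exists_isSmoothField_isVertical hF.contMDiff (hF.surjective_mfderiv x) hv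
  exact (tensorA_eq_zero_iff hXh hW hWv x).1 (hA X W hX hXh hW hWv x) u hu

variable [J.Boundaryless]

theorem inner_secondFundamentalFormAt_killing_of_mem (hF : IsRiemannianSubmersion I J F)
    (hξ : IsKillingField I ξ) (hξh : IsHorizontal I J F ξ) (hv : v ∈ verticalSpace I J F x)
    (hu : u ∈ verticalSpace I J F x) :
    (inner ℝ (secondFundamentalFormAt hF.contMDiff x v u) (mfderiv I J F x (ξ x)) : ℝ) = 0 := by
  have hξx := hξ.isSmoothField.mdifferentiableAt x
  have hvu := hF.inner_secondFundamentalFormAt_of_mem v hu hξx hξh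
  have huv := hF.inner_secondFundamentalFormAt_of_mem u hv hξx hξh
  rw [secondFundamentalFormAt_comm] at huv
  have hskew := hξ.inner_leviCivita x v u
  rw [real_inner_comm] at hskew
  linarith

theorem inner_secondFundamentalFormAt_of_mem_orthogonal (hF : IsRiemannianSubmersion I J F)
    (hdecomp : (verticalSpace I J F x)ᗮ
      = (verticalSpace I J F x).map (φ x) ⊔ Submodule.span ℝ {ξ x})
    (hφ : ∀ v ∈ verticalSpace I J F x,
      (inner ℝ (secondFundamentalFormAt hF.contMDiff x (ξ x) u) (mfderiv I J F x (φ x v)) : ℝ) = 0)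
    (hh : h ∈ (verticalSpace I J F x)ᗮ) :
    (inner ℝ (secondFundamentalFormAt hF.contMDiff x h u) (mfderiv I J F x (ξ x)) : ℝ) = 0 := by
  have hξh : ξ x ∈ (verticalSpace I J F x)ᗮ :=
    hdecomp ▸ Submodule.mem_sup_right (Submodule.mem_span_singleton_self _)
  have hξξ := hF.inner_secondFundamentalFormAt_self u hξh
  rw [secondFundamentalFormAt_comm] at hξξ
  rw [secondFundamentalFormAt_comm, hF.inner_secondFundamentalFormAt_antisymm u hh hξh,
    secondFundamentalFormAt_comm, neg_eq_zero,
    hF.secondFundamentalFormAt_eq_zero_of_inner_eq_zero hdecomp hφ hξξ, inner_zero_left]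

theorem secondFundamentalFormAt_eq_zero_of_forall_mem (hF : IsRiemannianSubmersion I J F)
    (hu : ∀ w, ∀ u ∈ verticalSpace I J F x, secondFundamentalFormAt hF.contMDiff x w u = 0)
    (v w : TangentSpace I x) : secondFundamentalFormAt hF.contMDiff x v w = 0 := by
  obtain ⟨u, hu', h, hh, rfl⟩ := (verticalSpace I J F x).exists_add_mem_mem_orthogonal v
  obtain ⟨u', hu'', k, hk, rfl⟩ := (verticalSpace I J F x).exists_add_mem_mem_orthogonal w
  rw [map_add, hu _ _ hu'', zero_add, map_add, _root_.add_apply, secondFundamentalFormAt_comm,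
    hu _ _ hu', hF.secondFundamentalFormAt_of_mem_orthogonal hh hk, add_zero]

end IsRiemannianSubmersion

end HorizontalDecomposition

end

end SasakianSubmersion

open SasakianSubmersion Bundle in
theorem theorem12_general
    {E : Type*} [NormedAddCommGroup E] [NormedSpace ℝ E] [FiniteDimensional ℝ E]
    {H : Type*} [TopologicalSpace H] {I : ModelWithCorners ℝ E H} [I.Boundaryless]
    {M : Type*} [TopologicalSpace M] [T2Space M] [ChartedSpace H M] [IsManifold I ∞ M]
    [RiemannianBundle (fun x : M ↦ TangentSpace I x)]
    [IsContMDiffRiemannianBundle I ∞ E (fun x : M ↦ TangentSpace I x)]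
    {E' : Type*} [NormedAddCommGroup E'] [NormedSpace ℝ E'] [FiniteDimensional ℝ E']
    {H' : Type*} [TopologicalSpace H'] {J : ModelWithCorners ℝ E' H'} [J.Boundaryless]
    {N : Type*} [TopologicalSpace N] [ChartedSpace H' N] [IsManifold J ∞ N]
    [RiemannianBundle (fun x : N ↦ TangentSpace J x)]
    [IsContMDiffRiemannianBundle J ∞ E' (fun x : N ↦ TangentSpace J x)]
    {φ : Π x : M, TangentSpace I x →ₗ[ℝ] TangentSpace I x}
    (hφ : ∀ V : Π x : M, TangentSpace I x, IsSmoothField I V → IsSmoothField I fun x ↦ φ x (V x))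
    {ξ : Π x : M, TangentSpace I x} (hξ : IsKillingField I ξ)
    {F : M → N} (hF : IsRiemannianSubmersion I J F)
    (hdecomp : ∀ x : M, (verticalSpace I J F x)ᗮ
      = (verticalSpace I J F x).map (φ x) ⊔ Submodule.span ℝ {ξ x}) :
    IsTotallyGeodesicMap I J F ↔
      (∀ V W : Π x : M, TangentSpace I x, IsSmoothField I V → IsVertical I J F V →
          IsSmoothField I W → IsVertical I J F W →
          ∀ x, tensorT I J F W (fun x ↦ φ x (V x)) x = 0) ∧
      (∀ X W : Π x : M, TangentSpace I x, IsSmoothField I X → IsHorizontal I J F X →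
          IsSmoothField I W → IsVertical I J F W →
          ∀ x, tensorA I J F X (fun x ↦ φ x (W x)) x = 0) := by
  have hξh : IsHorizontal I J F ξ := fun x ↦
    hdecomp x ▸ Submodule.mem_sup_right (Submodule.mem_span_singleton_self _)
  rw [isTotallyGeodesicMap_iff hF.contMDiff,
    hF.forall_tensorT_eq_zero_iff hφ fun x ↦ hdecomp x ▸ le_sup_left,
    hF.forall_tensorA_eq_zero_iff hφ hξ.isSmoothField hdecomp]
  refine ⟨fun hb ↦ ⟨fun x w _ u _ v _ ↦ ?_, fun x h _ u _ v _ ↦ ?_⟩, fun ⟨hT, hA⟩ x ↦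
    hF.secondFundamentalFormAt_eq_zero_of_forall_mem fun w u hu ↦ ?_⟩
  · rw [hb, inner_zero_left]
  · rw [hb, inner_zero_left]
  obtain ⟨v, hv, h, hh, rfl⟩ := (verticalSpace I J F x).exists_add_mem_mem_orthogonal w
  have hvu := hF.secondFundamentalFormAt_eq_zero_of_inner_eq_zero (hdecomp x) (hT x v hv u hu)
    (hF.inner_secondFundamentalFormAt_killing_of_mem hξ hξh hv hu)
  have hhu := hF.secondFundamentalFormAt_eq_zero_of_inner_eq_zero (hdecomp x) (hA x h hh u hu)
    (hF.inner_secondFundamentalFormAt_of_mem_orthogonal (hdecomp x) (hA x _ (hξh x) u hu) hh)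
  rw [map_add, add_apply, hvu, hhu, add_zero]

open SasakianSubmersion Bundle in
theorem theorem12
    {E : Type*} [NormedAddCommGroup E] [NormedSpace ℝ E] [FiniteDimensional ℝ E]
    {M : Type*} [TopologicalSpace M] [T2Space M] [ChartedSpace E M] [IsManifold 𝓘(ℝ, E) ∞ M]
    [RiemannianBundle (fun x : M ↦ TangentSpace 𝓘(ℝ, E) x)]
    [IsContMDiffRiemannianBundle 𝓘(ℝ, E) ∞ E (fun x : M ↦ TangentSpace 𝓘(ℝ, E) x)]
    {E' : Type*} [NormedAddCommGroup E'] [NormedSpace ℝ E'] [FiniteDimensional ℝ E']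
    {N : Type*} [TopologicalSpace N] [T2Space N] [ChartedSpace E' N] [IsManifold 𝓘(ℝ, E') ∞ N]
    [RiemannianBundle (fun x : N ↦ TangentSpace 𝓘(ℝ, E') x)]
    [IsContMDiffRiemannianBundle 𝓘(ℝ, E') ∞ E' (fun x : N ↦ TangentSpace 𝓘(ℝ, E') x)]
    (S : AlmostContactMetricStructure 𝓘(ℝ, E) M) (F : M → N)
    (hF : IsAntiInvariantSubmersion 𝓘(ℝ, E') S F)
    (hdecomp : ∀ x : M, (verticalSpace 𝓘(ℝ, E) 𝓘(ℝ, E') F x)ᗮ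
      = (verticalSpace 𝓘(ℝ, E) 𝓘(ℝ, E') F x).map (S.φ x).toLinearMap
        ⊔ Submodule.span ℝ {S.ξ x}) :
    IsTotallyGeodesicMap 𝓘(ℝ, E) 𝓘(ℝ, E') F ↔
      (∀ V W : Π x : M, TangentSpace 𝓘(ℝ, E) x,
          IsSmoothField 𝓘(ℝ, E) V → IsVertical 𝓘(ℝ, E) 𝓘(ℝ, E') F V →
          IsSmoothField 𝓘(ℝ, E) W → IsVertical 𝓘(ℝ, E) 𝓘(ℝ, E') F W →
          ∀ x, tensorT 𝓘(ℝ, E) 𝓘(ℝ, E') F W (S.phi V) x = 0) ∧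
      (∀ X W : Π x : M, TangentSpace 𝓘(ℝ, E) x,
          IsSmoothField 𝓘(ℝ, E) X → IsHorizontal 𝓘(ℝ, E) 𝓘(ℝ, E') F X →
          IsSmoothField 𝓘(ℝ, E) W → IsVertical 𝓘(ℝ, E) 𝓘(ℝ, E') F W →
          ∀ x, tensorA 𝓘(ℝ, E) 𝓘(ℝ, E') F X (S.phi W) x = 0) :=
  theorem12_general (φ := fun x ↦ (S.φ x).toLinearMap) (fun _ ↦ S.isSmoothField_phi)
    hF.isSasakian.isKillingField_ξ hF.isRiemannianSubmersion hdecomp
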